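/- Let $H_0,V\in\mathbb C^{2\times 2}$ be Hermitian with $[H_0,V]\neq 0$ and $\mathrm{Tr}\,V=0$, let $f_0=-\mathrm{Tr}(H_0V)/\mathrm{Tr}(V^2)$, and let $T>0$ satisfy $T\ge \pi/\|H_0-\tfrac12\mathrm{Tr}(H_0)\,\mathbb I+f_0V\|$, where $\|\cdot\|$ is the spectral norm. For a control $f\in L^1([0,T];\mathbb R)$ let $U^f_t$ be the absolutely continuous solution on $[0,T]$ of $i\,\frac{d}{dt}U^f_t=(H_0+f(t)V)U^f_t$ (for almost every $t$), $U^f_0=\mathbb I$. Let $W\in U(2)$ and let $\mathscr F_W(f)=\tfrac14|\mathrm{Tr}(W^\dagger U^f_T)|^2$ on $L^1([0,T];\mathbb R)$. Then the only extrema of $\mathscr F_W$ are global maxima and global minima, with values $1$ and $0$ respectively: every local maximum $f$ of $\mathscr F_W$ (with respect to the $L^1$-norm) is a global maximum with $\mathscr F_W(f)=1$, and every local minimum $f$ is a global minimum with $\mathscr F_W(f)=0$. Moreover, every critical point $f$ of $\mathscr F_W$ (all directional derivatives at $f$ exist and vanish) that is not almost everywhere equal to the constant $f_0$ is either a global maximum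 with value $1$ or a global minimum with value $0$. -/

import Mathlib

open MeasureTheory Set Matrix
open scoped Interval

namespace QubitControl

/-! ## Linear Volterra equations with integrable coefficients -/

section Volterra

theorem integral_mul_primitive_pow {k : ℝ → ℝ} {T : ℝ} (hk : IntervalIntegrable k volume 0 T)
    (n : ℕ) {t : ℝ} (ht : t ∈ [[0, T]]) :
    ∫ s in (0 : ℝ)..t, k s * (∫ r in (0 : ℝ)..s, k r) ^ n =
      (∫ r in (0 : ℝ)..t, k r) ^ (n + 1) / (n + 1) := by
  have hsub : [[0, t]] ⊆ [[0, T]] := uIcc_subset_uIcc left_mem_uIcc ht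
  have hkt : IntervalIntegrable k volume 0 t := hk.mono_set hsub
  have hK : AbsolutelyContinuousOnInterval (fun x ↦ ∫ r in (0 : ℝ)..x, k r) 0 t :=
    hkt.absolutelyContinuousOnInterval_intervalIntegral left_mem_uIcc
  have hpow : ∀ m : ℕ,
      AbsolutelyContinuousOnInterval (fun x ↦ (∫ r in (0 : ℝ)..x, k r) ^ (m + 1)) 0 t := by
    intro m
    induction m with
    | zero => simpa using hK
    | succ m ih => simpa [pow_succ] using ih.fun_mul hK
  have h := (hpow n).integral_deriv_eq_sub
  have hc : ∫ s in (0 : ℝ)..t, deriv (fun x ↦ (∫ r in (0 : ℝ)..x, k r) ^ (n + 1)) s =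
      ∫ s in (0 : ℝ)..t, ((n : ℝ) + 1) * (k s * (∫ r in (0 : ℝ)..s, k r) ^ n) := by
    apply intervalIntegral.integral_congr_ae
    filter_upwards [hkt.ae_hasDerivAt_integral] with x hx hx'
    have h1 := (hx (uIoc_subset_uIcc hx') 0 left_mem_uIcc).fun_pow (n + 1)
    rw [h1.deriv]
    rw [Nat.add_sub_cancel]
    push_cast
    ring
  rw [hc, intervalIntegral.integral_const_mul] at h
  have hn : (n : ℝ) + 1 ≠ 0 := by positivity
  rw [eq_div_iff hn, mul_comm, h]
  simp

variable {E : Type*} [NormedRing E] [NormedAlgebra ℝ E]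

theorem volterra_bound {A D D' : ℝ → E} {T C : ℝ} (hT : 0 ≤ T)
    (hA : IntervalIntegrable A volume 0 T) (n : ℕ)
    (hD : ∀ t ∈ Icc 0 T, ‖D t‖ ≤ C * ((∫ r in (0 : ℝ)..t, ‖A r‖) ^ n / n.factorial))
    (hD' : ∀ t ∈ Icc 0 T, D' t = ∫ s in (0 : ℝ)..t, A s * D s) :
    ∀ t ∈ Icc 0 T, ‖D' t‖ ≤
      C * ((∫ r in (0 : ℝ)..t, ‖A r‖) ^ (n + 1) / (n + 1).factorial) := by
  intro t ht
  have htu : t ∈ [[0, T]] := by rwa [uIcc_of_le hT]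
  have hsub : [[0, t]] ⊆ [[0, T]] := uIcc_subset_uIcc left_mem_uIcc htu
  have hAt : IntervalIntegrable A volume 0 t := hA.mono_set hsub
  have hK : ContinuousOn (fun x ↦ ∫ r in (0 : ℝ)..x, ‖A r‖) [[0, t]] :=
    (hAt.norm.absolutelyContinuousOnInterval_intervalIntegral left_mem_uIcc).continuousOn
  rw [hD' t ht]
  calc ‖∫ s in (0 : ℝ)..t, A s * D s‖
      ≤ ∫ s in (0 : ℝ)..t, C / n.factorial * (‖A s‖ * (∫ r in (0 : ℝ)..s, ‖A r‖) ^ n) := by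
        apply intervalIntegral.norm_integral_le_of_norm_le ht.1
        · refine Filter.Eventually.of_forall fun s hs ↦ ?_
          have hs' : s ∈ Icc 0 T := ⟨hs.1.le, hs.2.trans ht.2⟩
          calc ‖A s * D s‖ ≤ ‖A s‖ * ‖D s‖ := norm_mul_le _ _
            _ ≤ ‖A s‖ * (C * ((∫ r in (0 : ℝ)..s, ‖A r‖) ^ n / n.factorial)) := by
                gcongr
                exact hD s hs'
            _ = _ := by ring
        · exact (hAt.norm.mul_continuousOn (hK.pow n)).const_mul _
    _ = _ := by
        rw [intervalIntegral.integral_const_mul, integral_mul_primitive_pow hA.norm n htu,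
          Nat.factorial_succ]
        push_cast
        have : (n.factorial : ℝ) ≠ 0 := by positivity
        field_simp

theorem volterra_unique {A D : ℝ → E} {T : ℝ} (hT : 0 ≤ T)
    (hA : IntervalIntegrable A volume 0 T) (hc : ContinuousOn D (Icc 0 T))
    (hD : ∀ t ∈ Icc 0 T, D t = ∫ s in (0 : ℝ)..t, A s * D s) :
    ∀ t ∈ Icc 0 T, D t = 0 := by
  obtain ⟨C, hC⟩ := isCompact_Icc.exists_bound_of_continuousOn hc
  have hb : ∀ n : ℕ, ∀ t ∈ Icc 0 T,
      ‖D t‖ ≤ C * ((∫ r in (0 : ℝ)..t, ‖A r‖) ^ n / n.factorial) := by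
    intro n
    induction n with
    | zero => simpa using hC
    | succ n ih => exact volterra_bound hT hA n ih hD
  intro t ht
  have hlim := (FloorSemiring.tendsto_pow_div_factorial_atTop
    (∫ r in (0 : ℝ)..t, ‖A r‖)).const_mul C
  rw [mul_zero] at hlim
  exact norm_le_zero_iff.1 (ge_of_tendsto' hlim fun n ↦ hb n t ht)

theorem continuousOn_primitive_mul {A D : ℝ → E} {T : ℝ} (hT : 0 ≤ T)
    (hA : IntervalIntegrable A volume 0 T) (hc : ContinuousOn D (Icc 0 T)) :
    ContinuousOn (fun t ↦ ∫ s in (0 : ℝ)..t, A s * D s) (Icc 0 T) := by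
  have h : IntervalIntegrable (fun s ↦ A s * D s) volume 0 T :=
    hA.mul_continuousOn (by rwa [uIcc_of_le hT])
  have := intervalIntegral.continuousOn_primitive_interval (a := (0 : ℝ)) (b := T)
    (μ := volume) (f := fun s ↦ A s * D s)
    (by rw [uIcc_of_le hT]; exact (intervalIntegrable_iff_integrableOn_Icc_of_le hT).1 h)
  rwa [uIcc_of_le hT] at this

variable [CompleteSpace E]

theorem volterra_exists {A : ℝ → E} {T : ℝ} (hT : 0 ≤ T)
    (hA : IntervalIntegrable A volume 0 T) :
    ∃ U : ℝ → E, ContinuousOn U (Icc 0 T) ∧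
      ∀ t ∈ Icc 0 T, U t = 1 + ∫ s in (0 : ℝ)..t, A s * U s := by
  let D : ℕ → ℝ → E := fun n ↦
    Nat.rec (fun _ ↦ 1) (fun _ F t ↦ ∫ s in (0 : ℝ)..t, A s * F s) n
  have hD0 : ∀ t, D 0 t = 1 := fun _ ↦ rfl
  have hDs : ∀ n t, D (n + 1) t = ∫ s in (0 : ℝ)..t, A s * D n s := fun _ _ ↦ rfl
  have hcont : ∀ n, ContinuousOn (D n) (Icc 0 T) := by
    intro n
    induction n with
    | zero => exact continuousOn_const
    | succ n ih => exact continuousOn_primitive_mul hT hA ih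
  have hb : ∀ n : ℕ, ∀ t ∈ Icc 0 T,
      ‖D n t‖ ≤ ‖(1 : E)‖ * ((∫ r in (0 : ℝ)..t, ‖A r‖) ^ n / n.factorial) := by
    intro n
    induction n with
    | zero => intro t _; simp [hD0]
    | succ n ih => exact volterra_bound hT hA n ih fun t _ ↦ hDs n t
  have hKnn : ∀ t ∈ Icc 0 T, 0 ≤ ∫ r in (0 : ℝ)..t, ‖A r‖ := fun t ht ↦
    intervalIntegral.integral_nonneg ht.1 fun _ _ ↦ norm_nonneg _
  set M : ℝ := ∫ r in (0 : ℝ)..T, ‖A r‖ with hM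
  have hKM : ∀ t ∈ Icc 0 T, ∫ r in (0 : ℝ)..t, ‖A r‖ ≤ M := by
    intro t ht
    refine intervalIntegral.integral_mono_interval le_rfl ht.1 ht.2
      (Filter.Eventually.of_forall fun _ ↦ norm_nonneg _) hA.norm
  let u : ℕ → ℝ := fun n ↦ ‖(1 : E)‖ * (M ^ n / n.factorial)
  have hu : Summable u := (Real.summable_pow_div_factorial M).mul_left _
  have hbu : ∀ (n : ℕ) (t : ℝ), t ∈ Icc 0 T → ‖D n t‖ ≤ u n := by
    intro n t ht
    refine (hb n t ht).trans ?_
    have h1 := hKnn t ht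
    have h2 := hKM t ht
    dsimp only [u]
    gcongr
  have hsum : ∀ t ∈ Icc 0 T, Summable fun n ↦ D n t := fun t ht ↦
    Summable.of_norm_bounded hu fun n ↦ hbu n t ht
  refine ⟨fun t ↦ ∑' n, D n t, continuousOn_tsum hcont hu hbu, fun t ht ↦ ?_⟩
  have htu : t ∈ [[0, T]] := by rwa [uIcc_of_le hT]
  have hAt : IntervalIntegrable A volume 0 t :=
    hA.mono_set (uIcc_subset_uIcc left_mem_uIcc htu)
  have hmem : ∀ s ∈ Ι 0 t, s ∈ Icc 0 T := by
    intro s hs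
    rw [uIoc_of_le ht.1] at hs
    exact ⟨hs.1.le, hs.2.trans ht.2⟩
  have key : HasSum (fun n ↦ ∫ s in (0 : ℝ)..t, A s * D n s)
      (∫ s in (0 : ℝ)..t, A s * ∑' n, D n s) := by
    refine intervalIntegral.hasSum_integral_of_dominated_convergence
      (fun n s ↦ ‖A s‖ * u n) ?_ ?_ ?_ ?_ ?_
    · intro n
      have : IntervalIntegrable (fun s ↦ A s * D n s) volume 0 t :=
        hAt.mul_continuousOn ((hcont n).mono (by
          rw [uIcc_of_le ht.1]; exact Icc_subset_Icc le_rfl ht.2))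
      exact this.aestronglyMeasurable_restrict_uIoc
    · intro n
      refine Filter.Eventually.of_forall fun s hs ↦ ?_
      exact (norm_mul_le _ _).trans
        (mul_le_mul_of_nonneg_left (hbu n s (hmem s hs)) (norm_nonneg _))
    · exact Filter.Eventually.of_forall fun s _ ↦ hu.mul_left _
    · simp_rw [tsum_mul_left]
      exact hAt.norm.mul_const _
    · refine Filter.Eventually.of_forall fun s hs ↦ ?_
      exact (hsum s (hmem s hs)).hasSum.mul_left _
  change ∑' n, D n t = 1 + ∫ s in (0 : ℝ)..t, A s * ∑' n, D n s
  have := (hsum t ht).tsum_eq_zero_add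
  rw [this, hD0]
  congr 1
  simp_rw [hDs]
  exact key.tsum_eq

end Volterra

/-! ## The controlled two-level system -/

/-- The right-hand side `-i (H₀ + f(t) V)` of the Schrödinger equation. -/
noncomputable def generator (H₀ V : Matrix (Fin 2) (Fin 2) ℂ) (f : ℝ → ℝ) (t : ℝ) :
    Matrix (Fin 2) (Fin 2) ℂ :=
  (-Complex.I) • (H₀ + (f t : ℂ) • V)

/-- `U` solves `i dU/dt = (H₀ + f(t) V) U`, `U(0) = 1` on `[0, T]`: the entries of `U` are absolutely
continuous on `[0, T]` and the equation holds for almost every `t ∈ [0, T]`. -/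
structure IsEvolution (H₀ V : Matrix (Fin 2) (Fin 2) ℂ) (T : ℝ) (f : ℝ → ℝ)
    (U : ℝ → Matrix (Fin 2) (Fin 2) ℂ) : Prop where
  init : U 0 = 1
  absCont : ∀ i j, AbsolutelyContinuousOnInterval (fun t ↦ U t i j) 0 T
  schrodinger : ∀ᵐ t ∂(volume.restrict (Icc 0 T)), ∀ i j,
    HasDerivAt (fun s ↦ U s i j) ((generator H₀ V f t * U t) i j) t

theorem absolutelyContinuousOnInterval_primitive {g : ℝ → ℂ} {T : ℝ}
    (hg : IntervalIntegrable g volume 0 T) :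
    AbsolutelyContinuousOnInterval (fun t ↦ ∫ s in (0 : ℝ)..t, g s) 0 T := by
  have hre : IntervalIntegrable (fun s ↦ (g s).re) volume 0 T := ⟨hg.1.re, hg.2.re⟩
  have him : IntervalIntegrable (fun s ↦ (g s).im) volume 0 T := ⟨hg.1.im, hg.2.im⟩
  have hconst : ∀ c : ℂ, AbsolutelyContinuousOnInterval (fun _ : ℝ ↦ c) 0 T := fun c ↦
    (LipschitzWith.const c).lipschitzOnWith.absolutelyContinuousOnInterval
  have h1 := (hre.absolutelyContinuousOnInterval_intervalIntegral left_mem_uIcc).fun_smul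
    (hconst 1)
  have h2 := (him.absolutelyContinuousOnInterval_intervalIntegral left_mem_uIcc).fun_smul
    (hconst Complex.I)
  have h := h1.add h2
  rw [absolutelyContinuousOnInterval_iff] at h ⊢
  intro ε hε
  obtain ⟨δ, hδ, H⟩ := h ε hε
  refine ⟨δ, hδ, fun E hE hlt ↦ ?_⟩
  have hEq : ∀ t ∈ [[0, T]], ∫ s in (0 : ℝ)..t, g s =
      (∫ s in (0 : ℝ)..t, (g s).re) • (1 : ℂ) + (∫ s in (0 : ℝ)..t, (g s).im) • Complex.I := by
    intro t ht
    have hgt : IntervalIntegrable g volume 0 t :=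
      hg.mono_set (uIcc_subset_uIcc left_mem_uIcc ht)
    have e1 := Complex.reCLM.intervalIntegral_comp_comm hgt
    have e2 := Complex.imCLM.intervalIntegral_comp_comm hgt
    simp only [Complex.reCLM_apply, Complex.imCLM_apply] at e1 e2
    rw [e1, e2]
    apply Complex.ext <;> simp
  have := H E hE hlt
  refine lt_of_eq_of_lt (Finset.sum_congr rfl fun i hi ↦ ?_) this
  have hm := hE.1 i hi
  rw [hEq _ hm.1, hEq _ hm.2]
  rfl

section Matrices

open scoped Matrix.Norms.L2Operator

variable {H₀ V : Matrix (Fin 2) (Fin 2) ℂ} {T : ℝ} {f : ℝ → ℝ}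

theorem generator_intervalIntegrable (hf : IntegrableOn f (Icc 0 T)) (hT : 0 ≤ T) :
    IntervalIntegrable (generator H₀ V f) volume 0 T := by
  have h1 : IntervalIntegrable f volume 0 T :=
    (intervalIntegrable_iff_integrableOn_Icc_of_le hT).2 hf
  have h2 : IntervalIntegrable (fun t ↦ f t • V) volume 0 T := ⟨h1.1.smul_const V, h1.2.smul_const V⟩
  have h3 : IntervalIntegrable (fun t ↦ H₀ + f t • V) volume 0 T := intervalIntegrable_const.add h2
  exact ⟨h3.1.smul (-Complex.I), h3.2.smul (-Complex.I)⟩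

theorem integral_apply {G : ℝ → Matrix (Fin 2) (Fin 2) ℂ} {t : ℝ}
    (hG : IntervalIntegrable G volume 0 t) (i j : Fin 2) :
    (∫ s in (0 : ℝ)..t, G s) i j = ∫ s in (0 : ℝ)..t, G s i j := by
  let L : Matrix (Fin 2) (Fin 2) ℂ →L[ℝ] ℂ :=
    LinearMap.toContinuousLinearMap (Matrix.entryLinearMap ℝ ℂ i j)
  exact (L.intervalIntegral_comp_comm hG).symm

/-- The integral form of the Schrödinger equation. -/
theorem isEvolution_iff_integral (hf : IntegrableOn f (Icc 0 T)) (hT : 0 ≤ T)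
    {U : ℝ → Matrix (Fin 2) (Fin 2) ℂ} :
    IsEvolution H₀ V T f U ↔ ContinuousOn U (Icc 0 T) ∧
      ∀ t ∈ Icc 0 T, U t = 1 + ∫ s in (0 : ℝ)..t, generator H₀ V f s * U s := by
  have hA := generator_intervalIntegrable (H₀ := H₀) (V := V) hf hT
  have key : ContinuousOn U (Icc 0 T) → ∀ i j,
      IntervalIntegrable (fun s ↦ generator H₀ V f s * U s) volume 0 T ∧
      IntervalIntegrable (fun s ↦ (generator H₀ V f s * U s) i j) volume 0 T := by
    intro hU i j
    have h : IntervalIntegrable (fun s ↦ generator H₀ V f s * U s) volume 0 T :=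
      hA.mul_continuousOn (by rwa [uIcc_of_le hT])
    let L : Matrix (Fin 2) (Fin 2) ℂ →L[ℝ] ℂ :=
      LinearMap.toContinuousLinearMap (Matrix.entryLinearMap ℝ ℂ i j)
    exact ⟨h, L.integrable_comp h.1, L.integrable_comp h.2⟩
  constructor
  · intro h
    have hU : ContinuousOn U (Icc 0 T) := by
      refine continuousOn_pi.2 fun i ↦ continuousOn_pi.2 fun j ↦ ?_
      have := (h.absCont i j).continuousOn
      rwa [uIcc_of_le hT] at this
    refine ⟨hU, fun t ht ↦ ?_⟩
    have htu : t ∈ [[0, T]] := by rwa [uIcc_of_le hT]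
    ext i j
    obtain ⟨k1, k2⟩ := key hU i j
    rw [Matrix.add_apply, integral_apply (k1.mono_set (uIcc_subset_uIcc left_mem_uIcc htu))]
    have hac := (h.absCont i j).sub (absolutelyContinuousOnInterval_primitive k2)
    have hs := (ae_restrict_iff' measurableSet_Icc).1 h.schrodinger
    obtain ⟨C, hC⟩ := hac.const_of_ae_hasDerivAt_zero (by
      filter_upwards [hs, k2.ae_hasDerivAt_integral] with x h1 h2 hx
      have h1' := h1 (by rwa [uIcc_of_le hT] at hx) i j
      simpa using h1'.sub (h2 hx 0 left_mem_uIcc))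
    have e0 := hC 0 left_mem_uIcc
    have et := hC t htu
    simp only [Pi.sub_apply, intervalIntegral.integral_same, sub_zero, h.init] at e0 et
    rw [e0, ← et]
    ring
  · rintro ⟨hU, hI⟩
    have hentry : ∀ i j, ∀ t ∈ Icc 0 T, U t i j = (1 : Matrix (Fin 2) (Fin 2) ℂ) i j +
        ∫ s in (0 : ℝ)..t, (generator H₀ V f s * U s) i j := by
      intro i j t ht
      have htu : t ∈ [[0, T]] := by rwa [uIcc_of_le hT]
      rw [← integral_apply ((key hU i j).1.mono_set (uIcc_subset_uIcc left_mem_uIcc htu)),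
        ← Matrix.add_apply, ← hI t ht]
    refine ⟨by simpa using hI 0 ⟨le_rfl, hT⟩, fun i j ↦ ?_, ?_⟩
    · have h := absolutelyContinuousOnInterval_primitive (key hU i j).2
      rw [absolutelyContinuousOnInterval_iff] at h ⊢
      intro ε hε
      obtain ⟨δ, hδ, H⟩ := h ε hε
      refine ⟨δ, hδ, fun E hE hlt ↦ lt_of_eq_of_lt (Finset.sum_congr rfl fun m hm ↦ ?_) (H E hE hlt)⟩
      have hm' := hE.1 m hm
      rw [uIcc_of_le hT] at hm'
      rw [hentry i j _ hm'.1, hentry i j _ hm'.2, dist_add_left]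
    · rw [ae_restrict_iff' measurableSet_Icc]
      have hall : ∀ᵐ t, ∀ i j, t ∈ [[0, T]] → HasDerivAt
          (fun x ↦ ∫ s in (0 : ℝ)..x, (generator H₀ V f s * U s) i j)
          ((generator H₀ V f t * U t) i j) t := by
        rw [ae_all_iff]
        intro i
        rw [ae_all_iff]
        intro j
        filter_upwards [(key hU i j).2.ae_hasDerivAt_integral] with x hx hxm
        exact hx hxm 0 left_mem_uIcc
      have h0 : ∀ᵐ x : ℝ, x ≠ 0 := by simp [ae_iff, measure_singleton]
      have h1 : ∀ᵐ x : ℝ, x ≠ T := by simp [ae_iff, measure_singleton]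
      filter_upwards [hall, h0, h1] with t ht ht0 htT htm i j
      have hd := (ht i j (by rwa [uIcc_of_le hT])).const_add ((1 : Matrix (Fin 2) (Fin 2) ℂ) i j)
      refine hd.congr_of_eventuallyEq ?_
      filter_upwards [Icc_mem_nhds (lt_of_le_of_ne htm.1 (Ne.symm ht0))
        (lt_of_le_of_ne htm.2 htT)] with x hx
      exact hentry i j x hx

theorem exists_isEvolution (H₀ V : Matrix (Fin 2) (Fin 2) ℂ) (T : ℝ) (f : ℝ → ℝ)
    (hf : IntegrableOn f (Icc 0 T)) : ∃ U, IsEvolution H₀ V T f U := by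
  rcases le_or_gt 0 T with hT | hT
  · obtain ⟨U, hU⟩ := volterra_exists hT (generator_intervalIntegrable (H₀ := H₀) (V := V) hf hT)
    exact ⟨U, (isEvolution_iff_integral hf hT).2 hU⟩
  · refine ⟨fun _ ↦ 1, rfl, fun i j ↦ ?_, ?_⟩
    · exact (LipschitzWith.const _).lipschitzOnWith.absolutelyContinuousOnInterval
    · simp [Icc_eq_empty_of_lt hT]

theorem IsEvolution.unique {U U' : ℝ → Matrix (Fin 2) (Fin 2) ℂ}
    (hf : IntegrableOn f (Icc 0 T)) (hT : 0 ≤ T) (hU : IsEvolution H₀ V T f U)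
    (hU' : IsEvolution H₀ V T f U') : ∀ t ∈ Icc 0 T, U t = U' t := by
  have hA := generator_intervalIntegrable (H₀ := H₀) (V := V) hf hT
  obtain ⟨c, e⟩ := (isEvolution_iff_integral hf hT).1 hU
  obtain ⟨c', e'⟩ := (isEvolution_iff_integral hf hT).1 hU'
  have h := volterra_unique (D := fun t ↦ U t - U' t) hT hA (c.sub c') fun t ht ↦ by
    have htu : t ∈ [[0, T]] := by rwa [uIcc_of_le hT]
    have hsub : [[0, t]] ⊆ [[0, T]] := uIcc_subset_uIcc left_mem_uIcc htu
    have i1 : IntervalIntegrable (fun s ↦ generator H₀ V f s * U s) volume 0 t :=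
      (hA.mul_continuousOn (by rwa [uIcc_of_le hT])).mono_set hsub
    have i2 : IntervalIntegrable (fun s ↦ generator H₀ V f s * U' s) volume 0 t :=
      (hA.mul_continuousOn (by rwa [uIcc_of_le hT])).mono_set hsub
    simp_rw [mul_sub]
    rw [intervalIntegral.integral_sub i1 i2, e t ht, e' t ht]
    abel
  exact fun t ht ↦ sub_eq_zero.1 (h t ht)

end Matrices

/-- The space of controls `L¹([0, T]; ℝ)`. -/
abbrev Control (T : ℝ) : Type := Lp ℝ 1 (volume.restrict (Icc (0 : ℝ) T))

theorem Control.integrableOn {T : ℝ} (f : Control T) : IntegrableOn f (Icc 0 T) :=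
  L1.integrable_coeFn f

/-- The evolution operator `U^f_t`, `t ∈ [0, T]`, induced by the control `f`. -/
noncomputable def evolution (H₀ V : Matrix (Fin 2) (Fin 2) ℂ) {T : ℝ} (f : Control T) :
    ℝ → Matrix (Fin 2) (Fin 2) ℂ :=
  (exists_isEvolution H₀ V T f f.integrableOn).choose

theorem evolution_isEvolution (H₀ V : Matrix (Fin 2) (Fin 2) ℂ) {T : ℝ} (f : Control T) :
    IsEvolution H₀ V T f (evolution H₀ V f) :=
  (exists_isEvolution H₀ V T f f.integrableOn).choose_spec

/-- The gate-generation objective `¼ |Tr (W† U^f_T)|²`. -/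
noncomputable def gateObjective (H₀ V W : Matrix (Fin 2) (Fin 2) ℂ) (T : ℝ) (f : Control T) : ℝ :=
  (1 / 4) * ‖(Wᴴ * evolution H₀ V f T).trace‖ ^ 2

/-- The exceptional value `f₀ = -Tr (H₀ V) / Tr (V²)` of the control, for Hermitian `H₀` and
Hermitian traceless `V` (both traces are then real). -/
noncomputable def exceptionalValue (H₀ V : Matrix (Fin 2) (Fin 2) ℂ) : ℝ :=
  -(H₀ * V).trace.re / (V * V).trace.re

/-- The spectral norm of a matrix, i.e. its operator norm for the Euclidean norm on `ℂ²`. -/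
noncomputable def matrixSpectralNorm (A : Matrix (Fin 2) (Fin 2) ℂ) : ℝ :=
  ‖Matrix.toEuclideanCLM (n := Fin 2) (𝕜 := ℂ) A‖

/-- `f` is a critical point of the functional `F`: the first variation of `F` at `f` exists and
vanishes in every direction. -/
def IsCriticalControl {T : ℝ} (F : Control T → ℝ) (f : Control T) : Prop :=
  ∀ g : Control T, HasLineDerivAt ℝ F 0 f g

end QubitControl

namespace QubitControl

/-! ## Products of evolution operators -/

section Evolution

open scoped Matrix.Norms.L2Operator

variable {H₀ V : Matrix (Fin 2) (Fin 2) ℂ} {T : ℝ} {f g : ℝ → ℝ}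
  {U U' : ℝ → Matrix (Fin 2) (Fin 2) ℂ}

theorem hasDerivAt_matrix_iff {U : ℝ → Matrix (Fin 2) (Fin 2) ℂ}
    {U' : Matrix (Fin 2) (Fin 2) ℂ} {t : ℝ} :
    HasDerivAt U U' t ↔ ∀ i j, HasDerivAt (fun s ↦ U s i j) (U' i j) t := by
  have h := hasDerivAt_pi (φ := U) (φ' := U') (x := t)
  simp only [hasDerivAt_pi] at h
  exact h

theorem absolutelyContinuousOnInterval_conj {u : ℝ → ℂ} {a b : ℝ}
    (hu : AbsolutelyContinuousOnInterval u a b) :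
    AbsolutelyContinuousOnInterval (fun t ↦ star (u t)) a b := by
  rw [absolutelyContinuousOnInterval_iff] at hu ⊢
  simpa only [dist_star_star] using hu

theorem absolutelyContinuousOnInterval_mul {u v : ℝ → ℂ} {a b : ℝ}
    (hu : AbsolutelyContinuousOnInterval u a b) (hv : AbsolutelyContinuousOnInterval v a b) :
    AbsolutelyContinuousOnInterval (fun t ↦ u t * v t) a b := by
  simpa only [smul_eq_mul] using hu.fun_smul hv

theorem absolutelyContinuousOnInterval_matrix_mul {A B : ℝ → Matrix (Fin 2) (Fin 2) ℂ} {a b : ℝ}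
    (hA : ∀ i j, AbsolutelyContinuousOnInterval (fun t ↦ A t i j) a b)
    (hB : ∀ i j, AbsolutelyContinuousOnInterval (fun t ↦ B t i j) a b) (i j : Fin 2) :
    AbsolutelyContinuousOnInterval (fun t ↦ (A t * B t) i j) a b := by
  simp only [Matrix.mul_apply, Fin.sum_univ_two]
  exact (absolutelyContinuousOnInterval_mul (hA _ _) (hB _ _)).fun_add
    (absolutelyContinuousOnInterval_mul (hA _ _) (hB _ _))

/-- The fundamental theorem of calculus for matrix-valued absolutely continuous functions. -/
theorem eq_add_integral_of_absolutelyContinuous {G G' : ℝ → Matrix (Fin 2) (Fin 2) ℂ} (hT : 0 ≤ T)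
    (hac : ∀ i j, AbsolutelyContinuousOnInterval (fun t ↦ G t i j) 0 T)
    (hG' : IntervalIntegrable G' volume 0 T)
    (hd : ∀ᵐ t, t ∈ Icc 0 T → HasDerivAt G (G' t) t) {t : ℝ} (ht : t ∈ Icc 0 T) :
    G t = G 0 + ∫ s in (0 : ℝ)..t, G' s := by
  have htu : t ∈ [[0, T]] := by rwa [uIcc_of_le hT]
  ext i j
  let L : Matrix (Fin 2) (Fin 2) ℂ →L[ℝ] ℂ :=
    LinearMap.toContinuousLinearMap (Matrix.entryLinearMap ℝ ℂ i j)
  have k2 : IntervalIntegrable (fun s ↦ G' s i j) volume 0 T :=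
    ⟨L.integrable_comp hG'.1, L.integrable_comp hG'.2⟩
  rw [Matrix.add_apply, integral_apply (hG'.mono_set (uIcc_subset_uIcc left_mem_uIcc htu))]
  obtain ⟨C, hC⟩ := ((hac i j).sub
    (absolutelyContinuousOnInterval_primitive k2)).const_of_ae_hasDerivAt_zero (by
      filter_upwards [hd, k2.ae_hasDerivAt_integral] with x h1 h2 hx
      have h1' := hasDerivAt_matrix_iff.1 (h1 (by rwa [uIcc_of_le hT] at hx)) i j
      simpa using h1'.sub (h2 hx 0 left_mem_uIcc))
  have e0 := hC 0 left_mem_uIcc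
  have et := hC t htu
  simp only [Pi.sub_apply, intervalIntegral.integral_same, sub_zero] at e0 et
  rw [e0, ← et]
  ring

theorem IsEvolution.ae_hasDerivAt (hU : IsEvolution H₀ V T f U) :
    ∀ᵐ t, t ∈ Icc 0 T → HasDerivAt U (generator H₀ V f t * U t) t := by
  filter_upwards [(ae_restrict_iff' measurableSet_Icc).1 hU.schrodinger] with t ht htm
  exact hasDerivAt_matrix_iff.2 (ht htm)

theorem IsEvolution.continuousOn (hU : IsEvolution H₀ V T f U) (hT : 0 ≤ T) :
    ContinuousOn U (Icc 0 T) := by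
  refine continuousOn_pi.2 fun i ↦ continuousOn_pi.2 fun j ↦ ?_
  have := (hU.absCont i j).continuousOn
  rwa [uIcc_of_le hT] at this

theorem IsEvolution.congr_ae (hU : IsEvolution H₀ V T f U)
    (hfg : f =ᵐ[volume.restrict (Icc 0 T)] g) : IsEvolution H₀ V T g U := by
  refine ⟨hU.init, hU.absCont, ?_⟩
  filter_upwards [hU.schrodinger, hfg] with t ht h
  simpa only [generator, h] using ht

/-- The derivative of `U† B U'` for two evolutions `U` and `U'`. -/
noncomputable def heisenberg (H₀ V B : Matrix (Fin 2) (Fin 2) ℂ) (f g : ℝ → ℝ)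
    (U U' : ℝ → Matrix (Fin 2) (Fin 2) ℂ) (t : ℝ) : Matrix (Fin 2) (Fin 2) ℂ :=
  (U t)ᴴ * (Complex.I • ((H₀ + (f t : ℂ) • V) * B - B * (H₀ + (g t : ℂ) • V))) * U' t

theorem conjTranspose_generator (hH₀ : H₀.IsHermitian) (hV : V.IsHermitian) (f : ℝ → ℝ) (t : ℝ) :
    (generator H₀ V f t)ᴴ = Complex.I • (H₀ + (f t : ℂ) • V) := by
  rw [generator, conjTranspose_smul, conjTranspose_add, conjTranspose_smul, hH₀.eq, hV.eq]
  simp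

theorem IsEvolution.ae_hasDerivAt_conj (hH₀ : H₀.IsHermitian) (hV : V.IsHermitian)
    (hU : IsEvolution H₀ V T f U) (hU' : IsEvolution H₀ V T g U') (B : Matrix (Fin 2) (Fin 2) ℂ) :
    ∀ᵐ t, t ∈ Icc 0 T →
      HasDerivAt (fun s ↦ (U s)ᴴ * B * U' s) (heisenberg H₀ V B f g U U' t) t := by
  filter_upwards [hU.ae_hasDerivAt, hU'.ae_hasDerivAt] with t h h' htm
  have h1 := h htm
  have h2 := h' htm
  have h3 := (h1.star.mul_const B).mul h2
  refine h3.congr_deriv ?_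
  rw [star_eq_conjTranspose, star_eq_conjTranspose, conjTranspose_mul,
    conjTranspose_generator hH₀ hV, heisenberg, generator]
  simp only [smul_mul_assoc, mul_smul_comm, mul_sub, sub_mul, smul_sub, neg_smul,
    Matrix.mul_assoc, mul_neg, neg_mul]
  exact (sub_eq_add_neg _ _).symm

theorem IsEvolution.absCont_conj
    (hU : IsEvolution H₀ V T f U) (hU' : IsEvolution H₀ V T g U') (B : Matrix (Fin 2) (Fin 2) ℂ)
    (i j : Fin 2) : AbsolutelyContinuousOnInterval (fun s ↦ ((U s)ᴴ * B * U' s) i j) 0 T := by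
  refine absolutelyContinuousOnInterval_matrix_mul (absolutelyContinuousOnInterval_matrix_mul
    (fun i j ↦ ?_) (fun i j ↦ ?_)) hU'.absCont i j
  · exact absolutelyContinuousOnInterval_conj (hU.absCont j i)
  · exact (LipschitzWith.const _).lipschitzOnWith.absolutelyContinuousOnInterval

theorem intervalIntegrable_ofReal_smul (hf : IntervalIntegrable f volume 0 T)
    (B : Matrix (Fin 2) (Fin 2) ℂ) :
    IntervalIntegrable (fun t ↦ (f t : ℂ) • B) volume 0 T := by
  have h2 : IntervalIntegrable (fun t ↦ f t • B) volume 0 T := ⟨hf.1.smul_const B, hf.2.smul_const B⟩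
  exact h2

theorem continuousOn_conjTranspose (hU : ContinuousOn U (Icc 0 T)) :
    ContinuousOn (fun t ↦ (U t)ᴴ) (Icc 0 T) := hU.star

theorem heisenberg_intervalIntegrable (hT : 0 ≤ T) (hf : IntegrableOn f (Icc 0 T))
    (hg : IntegrableOn g (Icc 0 T)) (hU : IsEvolution H₀ V T f U) (hU' : IsEvolution H₀ V T g U')
    (B : Matrix (Fin 2) (Fin 2) ℂ) :
    IntervalIntegrable (heisenberg H₀ V B f g U U') volume 0 T := by
  have hf' : IntervalIntegrable f volume 0 T :=
    (intervalIntegrable_iff_integrableOn_Icc_of_le hT).2 hf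
  have hg' : IntervalIntegrable g volume 0 T :=
    (intervalIntegrable_iff_integrableOn_Icc_of_le hT).2 hg
  have h : IntervalIntegrable (fun t ↦ Complex.I • (H₀ * B - B * H₀) +
      (f t : ℂ) • (Complex.I • (V * B)) - (g t : ℂ) • (Complex.I • (B * V))) volume 0 T :=
    (intervalIntegrable_const.add (intervalIntegrable_ofReal_smul hf' _)).sub
      (intervalIntegrable_ofReal_smul hg' _)
  have hc := continuousOn_conjTranspose (hU.continuousOn hT)
  have hc' := hU'.continuousOn hT
  rw [← uIcc_of_le hT] at hc hc'
  refine ((h.continuousOn_mul hc).mul_continuousOn hc').congr ?_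
  intro t _
  simp only [heisenberg]
  congr 2
  simp only [add_mul, mul_add, smul_sub, smul_add, smul_mul_assoc, mul_smul_comm]
  rw [smul_comm (f t : ℂ), smul_comm (g t : ℂ)]
  abel

theorem IsEvolution.conj_eq (hT : 0 ≤ T) (hH₀ : H₀.IsHermitian) (hV : V.IsHermitian)
    (hf : IntegrableOn f (Icc 0 T)) (hg : IntegrableOn g (Icc 0 T))
    (hU : IsEvolution H₀ V T f U) (hU' : IsEvolution H₀ V T g U') (B : Matrix (Fin 2) (Fin 2) ℂ)
    {t : ℝ} (ht : t ∈ Icc 0 T) :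
    (U t)ᴴ * B * U' t = B + ∫ s in (0 : ℝ)..t, heisenberg H₀ V B f g U U' s := by
  have h := eq_add_integral_of_absolutelyContinuous hT (hU.absCont_conj hU' B)
    (heisenberg_intervalIntegrable hT hf hg hU hU' B) (hU.ae_hasDerivAt_conj hH₀ hV hU' B) ht
  rw [h, hU.init, hU'.init]
  simp

theorem IsEvolution.conjTranspose_mul_self (hT : 0 ≤ T) (hH₀ : H₀.IsHermitian)
    (hV : V.IsHermitian) (hf : IntegrableOn f (Icc 0 T)) (hU : IsEvolution H₀ V T f U)
    {t : ℝ} (ht : t ∈ Icc 0 T) : (U t)ᴴ * U t = 1 := by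
  have h := hU.conj_eq hT hH₀ hV hf hf hU 1 ht
  simpa [heisenberg] using h

theorem norm_eq_one_of_conjTranspose_mul_self {A : Matrix (Fin 2) (Fin 2) ℂ} (hA : Aᴴ * A = 1) :
    ‖A‖ = 1 :=
  CStarRing.norm_of_mem_unitary (Matrix.mem_unitaryGroup_iff'.2 hA)

theorem heisenberg_one (f g : ℝ → ℝ) (t : ℝ) : heisenberg H₀ V 1 f g U U' t =
    ((f t - g t : ℝ) : ℂ) • (Complex.I • ((U t)ᴴ * V * U' t)) := by
  simp only [heisenberg, mul_one, one_mul, add_sub_add_left_eq_sub, ← sub_smul, smul_mul_assoc,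
    mul_smul_comm, smul_smul, Complex.ofReal_sub]
  rw [mul_comm]

theorem norm_conj_sub_one_le (hT : 0 ≤ T) (hH₀ : H₀.IsHermitian)
    (hV : V.IsHermitian) (hf : IntegrableOn f (Icc 0 T)) (hg : IntegrableOn g (Icc 0 T))
    (hU : IsEvolution H₀ V T f U) (hU' : IsEvolution H₀ V T g U') {t : ℝ} (ht : t ∈ Icc 0 T) :
    ‖(U t)ᴴ * U' t - 1‖ ≤ ‖V‖ * ∫ s in (0 : ℝ)..T, |f s - g s| := by
  have h := hU.conj_eq hT hH₀ hV hf hg hU' 1 ht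
  have hfg : IntervalIntegrable (fun s ↦ |f s - g s|) volume 0 T :=
    ((intervalIntegrable_iff_integrableOn_Icc_of_le hT).2 (hf.sub hg)).norm
  have htu : t ∈ [[0, T]] := by rwa [uIcc_of_le hT]
  rw [mul_one] at h
  rw [h, add_sub_cancel_left]
  calc _ ≤ ∫ s in (0 : ℝ)..t, ‖V‖ * |f s - g s| := by
        refine intervalIntegral.norm_integral_le_of_norm_le ht.1 ?_
          ((hfg.mono_set (uIcc_subset_uIcc left_mem_uIcc htu)).const_mul _)
        refine Filter.Eventually.of_forall fun s hs ↦ ?_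
        have hs' : s ∈ Icc 0 T := ⟨hs.1.le, hs.2.trans ht.2⟩
        have h1 := norm_eq_one_of_conjTranspose_mul_self
          (hU.conjTranspose_mul_self hT hH₀ hV hf hs')
        have h2 := norm_eq_one_of_conjTranspose_mul_self
          (hU'.conjTranspose_mul_self hT hH₀ hV hg hs')
        rw [heisenberg_one, norm_smul, norm_smul, Complex.norm_I, one_mul, Complex.norm_real,
          Real.norm_eq_abs, mul_comm]
        gcongr
        calc ‖(U s)ᴴ * V * U' s‖ ≤ ‖(U s)ᴴ‖ * ‖V‖ * ‖U' s‖ := norm_mul₃_le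
          _ = ‖V‖ := by rw [l2_opNorm_conjTranspose, h1, h2, one_mul, mul_one]
    _ ≤ ∫ s in (0 : ℝ)..T, ‖V‖ * |f s - g s| := by
        refine intervalIntegral.integral_mono_interval le_rfl ht.1 ht.2
          (Filter.Eventually.of_forall fun _ ↦ ?_) (hfg.const_mul _)
        exact mul_nonneg (norm_nonneg _) (abs_nonneg _)
    _ = _ := intervalIntegral.integral_const_mul _ _

theorem norm_sub_le_of_isEvolution (hT : 0 ≤ T) (hH₀ : H₀.IsHermitian)
    (hV : V.IsHermitian) (hf : IntegrableOn f (Icc 0 T)) (hg : IntegrableOn g (Icc 0 T))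
    (hU : IsEvolution H₀ V T f U) (hU' : IsEvolution H₀ V T g U') {t : ℝ} (ht : t ∈ Icc 0 T) :
    ‖U' t - U t‖ ≤ ‖V‖ * ∫ s in (0 : ℝ)..T, |f s - g s| := by
  have h1 := hU.conjTranspose_mul_self hT hH₀ hV hf ht
  have h2 : U' t - U t = U t * ((U t)ᴴ * U' t - 1) := by
    rw [mul_sub, ← Matrix.mul_assoc, mul_eq_one_comm.1 h1, one_mul, mul_one]
  rw [h2]
  refine (norm_mul_le _ _).trans ?_
  rw [norm_eq_one_of_conjTranspose_mul_self h1, one_mul]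
  exact norm_conj_sub_one_le hT hH₀ hV hf hg hU hU' ht

/-- The first variation of the evolution operator, with an explicit second-order remainder. -/
theorem norm_conj_sub_firstVariation_le (hT : 0 ≤ T) (hH₀ : H₀.IsHermitian)
    (hV : V.IsHermitian) (hf : IntegrableOn f (Icc 0 T)) (hg : IntegrableOn g (Icc 0 T))
    (ε : ℝ) (hU : IsEvolution H₀ V T f U)
    (hU' : IsEvolution H₀ V T (fun t ↦ f t + ε * g t) U') :
    ‖(U T)ᴴ * U' T - 1 -
      ε • ∫ s in (0 : ℝ)..T, (g s : ℂ) • (-Complex.I) • ((U s)ᴴ * V * U s)‖ ≤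
      (‖V‖ * ∫ s in (0 : ℝ)..T, |g s|) ^ 2 * ε ^ 2 := by
  have hTm : T ∈ Icc 0 T := ⟨hT, le_rfl⟩
  have hfg : IntegrableOn (fun t ↦ f t + ε * g t) (Icc 0 T) := hf.add (hg.const_mul ε)
  have hgi : IntervalIntegrable g volume 0 T :=
    (intervalIntegrable_iff_integrableOn_Icc_of_le hT).2 hg
  have h := hU.conj_eq hT hH₀ hV hf hfg hU' 1 hTm
  rw [mul_one] at h
  have habs : ∫ s in (0 : ℝ)..T, |f s - (f s + ε * g s)| = |ε| * ∫ s in (0 : ℝ)..T, |g s| := by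
    rw [← intervalIntegral.integral_const_mul]
    simp [abs_mul]
  have key : ∀ {U₁ : ℝ → Matrix (Fin 2) (Fin 2) ℂ}, ContinuousOn U₁ (Icc 0 T) →
      IntervalIntegrable (fun s ↦ (g s : ℂ) • (-Complex.I) • ((U s)ᴴ * V * U₁ s)) volume 0 T := by
    intro U₁ hU₁
    have hc := continuousOn_conjTranspose (hU.continuousOn hT)
    rw [← uIcc_of_le hT] at hc hU₁
    refine (((intervalIntegrable_ofReal_smul hgi ((-Complex.I) • V)).continuousOn_mul hc
      ).mul_continuousOn hU₁).congr ?_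
    intro t _
    simp only [smul_mul_assoc, mul_smul_comm]
  have hdiff : (U T)ᴴ * U' T - 1 -
      ε • ∫ s in (0 : ℝ)..T, (g s : ℂ) • (-Complex.I) • ((U s)ᴴ * V * U s) =
      ε • ∫ s in (0 : ℝ)..T, (g s : ℂ) • (-Complex.I) • ((U s)ᴴ * V * (U' s - U s)) := by
    rw [h, add_sub_cancel_left]
    simp_rw [mul_sub, smul_sub]
    rw [intervalIntegral.integral_sub (key (hU'.continuousOn hT)) (key (hU.continuousOn hT)),
      smul_sub]
    congr 1
    rw [← intervalIntegral.integral_smul]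
    refine intervalIntegral.integral_congr fun s _ ↦ ?_
    simp only [heisenberg_one, ← Complex.coe_smul, smul_smul]
    congr 1
    push_cast
    ring
  rw [hdiff, norm_smul, Real.norm_eq_abs]
  have hb : ‖∫ s in (0 : ℝ)..T, (g s : ℂ) • (-Complex.I) • ((U s)ᴴ * V * (U' s - U s))‖ ≤
      ∫ s in (0 : ℝ)..T, (‖V‖ * (‖V‖ * (|ε| * ∫ s in (0 : ℝ)..T, |g s|))) * |g s| := by
    refine intervalIntegral.norm_integral_le_of_norm_le hT ?_ (hgi.norm.const_mul _)
    refine Filter.Eventually.of_forall fun s hs ↦ ?_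
    have hs' : s ∈ Icc 0 T := ⟨hs.1.le, hs.2⟩
    have h1 := norm_eq_one_of_conjTranspose_mul_self
      (hU.conjTranspose_mul_self hT hH₀ hV hf hs')
    rw [norm_smul, norm_smul, norm_neg, Complex.norm_I, one_mul, Complex.norm_real,
      Real.norm_eq_abs, mul_comm]
    gcongr
    calc ‖(U s)ᴴ * V * (U' s - U s)‖ ≤ ‖(U s)ᴴ‖ * ‖V‖ * ‖U' s - U s‖ := norm_mul₃_le
      _ = ‖V‖ * ‖U' s - U s‖ := by rw [l2_opNorm_conjTranspose, h1, one_mul]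
      _ ≤ _ := by
        gcongr
        rw [← habs]
        exact norm_sub_le_of_isEvolution hT hH₀ hV hf hfg hU hU' hs'
  rw [intervalIntegral.integral_const_mul] at hb
  calc _ ≤ |ε| * (‖V‖ * (‖V‖ * (|ε| * ∫ s in (0 : ℝ)..T, |g s|)) *
        ∫ s in (0 : ℝ)..T, |g s|) := by gcongr
    _ = _ := by rw [← sq_abs ε]; ring

end Evolution

/-! ## Algebra of `2 × 2` matrices -/

section Algebra

open scoped ComplexOrder

theorem mul_add_mul_of_trace_eq_zero {A B : Matrix (Fin 2) (Fin 2) ℂ} (hA : A.trace = 0)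
    (hB : B.trace = 0) : A * B + B * A = (A * B).trace • (1 : Matrix (Fin 2) (Fin 2) ℂ) := by
  rw [trace_fin_two] at hA hB
  have hA' : A 1 1 = -A 0 0 := by linear_combination hA
  have hB' : B 1 1 = -B 0 0 := by linear_combination hB
  ext i j
  fin_cases i <;> fin_cases j <;>
    simp [Matrix.mul_apply, Fin.sum_univ_two, trace_fin_two, hA', hB'] <;> ring

theorem mul_eq_neg_mul_of_trace_eq_zero {A B : Matrix (Fin 2) (Fin 2) ℂ} (hA : A.trace = 0)
    (hB : B.trace = 0) (hAB : (A * B).trace = 0) : A * B = -(B * A) := by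
  have h := mul_add_mul_of_trace_eq_zero hA hB
  rw [hAB, zero_smul] at h
  exact eq_neg_of_add_eq_zero_left h

theorem eq_zero_of_trace_mul_eq_zero {A B Z : Matrix (Fin 2) (Fin 2) ℂ} {a b : ℂ}
    (hA : A.trace = 0) (hB : B.trace = 0) (hAB : (A * B).trace = 0) (hA2 : A * A = a • 1)
    (hB2 : B * B = b • 1) (ha : a ≠ 0) (hb : b ≠ 0) (hZ : Z.trace = 0) (hZA : (Z * A).trace = 0)
    (hZB : (Z * B).trace = 0) (hZAB : (Z * (A * B)).trace = 0) : Z = 0 := by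
  have h1 := mul_eq_neg_mul_of_trace_eq_zero hZ hA hZA
  have h2 := mul_eq_neg_mul_of_trace_eq_zero hZ hB hZB
  have h3 := mul_eq_neg_mul_of_trace_eq_zero hZ hAB hZAB
  have h4 : Z * (A * B) = A * B * Z := by
    rw [← Matrix.mul_assoc, h1, neg_mul, Matrix.mul_assoc, h2, mul_neg, neg_neg, Matrix.mul_assoc]
  have h5 : Z * (A * B) = 0 := by
    rw [← h4] at h3
    have h3' : (2 : ℂ) • (Z * (A * B)) = 0 := by
      rw [two_smul]
      exact eq_neg_iff_add_eq_zero.1 h3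
    exact (smul_eq_zero.1 h3').resolve_left two_ne_zero
  have h6 : Z * (A * B) * (B * A) = (a * b) • Z := by
    rw [Matrix.mul_assoc, Matrix.mul_assoc A, ← Matrix.mul_assoc B, hB2, smul_mul_assoc, one_mul,
      mul_smul_comm, hA2, smul_smul, mul_smul_comm, mul_one, mul_comm]
  rw [h5, zero_mul] at h6
  exact (smul_eq_zero.1 h6.symm).resolve_left (mul_ne_zero ha hb)

theorem smul_add_smul_conjTranspose_of_unitary {X : Matrix (Fin 2) (Fin 2) ℂ} (hX : Xᴴ * X = 1) :
    star X.trace • X + X.trace • Xᴴ =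
      (X.trace * star X.trace) • (1 : Matrix (Fin 2) (Fin 2) ℂ) := by
  have hadj : X.adjugate = X.trace • 1 - X := by
    rw [adjugate_fin_two, trace_fin_two]
    ext i j
    fin_cases i <;> fin_cases j <;> simp
  have h1 : X.det • Xᴴ = X.trace • 1 - X := by
    rw [← hadj, ← mul_one Xᴴ, ← mul_smul_comm, ← Matrix.mul_adjugate, ← Matrix.mul_assoc, hX,
      one_mul]
  have h2 : X.det * star X.trace = X.trace := by
    have := congrArg Matrix.trace h1
    rw [trace_smul, trace_conjTranspose, trace_sub, trace_smul, trace_one] at this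
    simp only [smul_eq_mul, Fintype.card_fin] at this
    rw [this]
    push_cast
    ring
  calc _ = star X.trace • (X + X.det • Xᴴ) := by
        rw [smul_add, smul_smul, mul_comm _ X.det, h2]
    _ = _ := by rw [h1, add_sub_cancel, smul_smul, mul_comm]

theorem trace_two_smul_sub_conjTranspose_mul {X : Matrix (Fin 2) (Fin 2) ℂ} (hX : Xᴴ * X = 1) :
    (((2 : ℂ) • X - X.trace • 1)ᴴ * ((2 : ℂ) • X - X.trace • 1)).trace =
      8 - 2 * (X.trace * star X.trace) := by
  rw [conjTranspose_sub, conjTranspose_smul, conjTranspose_smul, conjTranspose_one, sub_mul,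
    mul_sub, mul_sub]
  simp only [smul_mul_assoc, mul_smul_comm, hX, mul_one, one_mul, trace_sub, trace_smul, trace_one,
    trace_conjTranspose, smul_eq_mul, Fintype.card_fin, star_ofNat]
  push_cast
  ring

theorem norm_trace_sq (X : Matrix (Fin 2) (Fin 2) ℂ) :
    X.trace * star X.trace = ((‖X.trace‖ ^ 2 : ℝ) : ℂ) := by
  rw [Complex.star_def, Complex.mul_conj, Complex.normSq_eq_norm_sq]

theorem norm_trace_sq_le_of_unitary {X : Matrix (Fin 2) (Fin 2) ℂ} (hX : Xᴴ * X = 1) :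
    ‖X.trace‖ ^ 2 ≤ 4 := by
  have h := trace_two_smul_sub_conjTranspose_mul hX
  have h0 := (Matrix.posSemidef_conjTranspose_mul_self
    ((2 : ℂ) • X - X.trace • (1 : Matrix (Fin 2) (Fin 2) ℂ))).trace_nonneg
  rw [h, norm_trace_sq] at h0
  have h1 : (0 : ℂ) ≤ ((8 - 2 * ‖X.trace‖ ^ 2 : ℝ) : ℂ) := by
    push_cast at h0 ⊢
    exact h0
  have := Complex.zero_le_real.1 h1
  linarith

theorem eq_smul_one_of_norm_trace_sq_eq {X : Matrix (Fin 2) (Fin 2) ℂ} (hX : Xᴴ * X = 1)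
    (hz : ‖X.trace‖ ^ 2 = 4) : (2 : ℂ) • X = X.trace • 1 := by
  have h := trace_two_smul_sub_conjTranspose_mul hX
  rw [norm_trace_sq, hz] at h
  have h' := Matrix.trace_conjTranspose_mul_self_eq_zero_iff.1 (h.trans (by norm_num))
  exact sub_eq_zero.1 h'

theorem norm_trace_sq_eq_of_smul_eq {X : Matrix (Fin 2) (Fin 2) ℂ} (hX : Xᴴ * X = 1)
    (hz : X.trace ≠ 0) (hZ : star X.trace • X - X.trace • Xᴴ = 0) : ‖X.trace‖ ^ 2 = 4 := by
  have h := smul_add_smul_conjTranspose_of_unitary hX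
  have h1 : star X.trace • ((2 : ℂ) • X - X.trace • 1) = 0 := by
    rw [smul_sub, smul_smul, mul_comm, ← smul_smul, two_smul, smul_smul, mul_comm (star X.trace),
      ← h]
    rw [sub_eq_zero] at hZ
    rw [← hZ]
    exact sub_self _
  have h2 := (smul_eq_zero.1 h1).resolve_left (star_ne_zero.2 hz)
  have h3 := trace_two_smul_sub_conjTranspose_mul hX
  rw [h2, mul_zero, trace_zero, norm_trace_sq] at h3
  have h4 : (0 : ℝ) = 8 - 2 * ‖X.trace‖ ^ 2 := by exact_mod_cast h3
  linarith

theorem star_trace_mul {A B : Matrix (Fin 2) (Fin 2) ℂ} (hB : B.IsHermitian) :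
    star (A * B).trace = (Aᴴ * B).trace := by
  rw [← trace_conjTranspose, conjTranspose_mul, hB.eq, trace_mul_comm]

open scoped Matrix.Norms.L2Operator in
theorem mul_self_of_isHermitian {A : Matrix (Fin 2) (Fin 2) ℂ} (hA : A.IsHermitian)
    (htr : A.trace = 0) : A * A = ((matrixSpectralNorm A ^ 2 : ℝ) : ℂ) • 1 := by
  have h := mul_add_mul_of_trace_eq_zero htr htr
  have h0 := (Matrix.posSemidef_conjTranspose_mul_self A).trace_nonneg
  rw [hA.eq] at h0
  set c : ℂ := (1 / 2 : ℂ) * (A * A).trace with hc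
  have h1 : A * A = c • 1 := by
    rw [hc, ← smul_smul, ← h, ← two_smul ℂ, smul_smul]
    norm_num
  have h2 : ‖A * A‖ = ‖A‖ * ‖A‖ := by
    conv_lhs => rw [← hA.eq]
    simpa [hA.eq] using l2_opNorm_conjTranspose_mul_self A
  have h3 : ‖c‖ = matrixSpectralNorm A ^ 2 := by
    have : ‖A‖ = matrixSpectralNorm A := rfl
    rw [← this, sq, ← h2, h1, norm_smul, norm_one, mul_one]
  have h4 : (0 : ℂ) ≤ c := by
    rw [hc]
    exact mul_nonneg (by norm_num [Complex.le_def]) h0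
  rw [h1, ← h3]
  congr 1
  exact Complex.eq_coe_norm_of_nonneg h4

end Algebra

/-! ## The drift at the exceptional control -/

section Drift

variable {H₀ V : Matrix (Fin 2) (Fin 2) ℂ}

/-- The traceless part of the Hamiltonian `H₀ + f₀ V` at the exceptional control. -/
noncomputable def drift (H₀ V : Matrix (Fin 2) (Fin 2) ℂ) : Matrix (Fin 2) (Fin 2) ℂ :=
  H₀ - ((1 / 2 : ℂ) * H₀.trace) • 1 + (exceptionalValue H₀ V : ℂ) • V

theorem trace_eq_ofReal_re {A : Matrix (Fin 2) (Fin 2) ℂ} (hA : A.IsHermitian) :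
    A.trace = (A.trace.re : ℂ) := by
  have h := trace_conjTranspose A
  rw [hA.eq] at h
  exact (Complex.conj_eq_iff_re.1 h.symm).symm

theorem drift_isHermitian (hH₀ : H₀.IsHermitian) (hV : V.IsHermitian) :
    (drift H₀ V).IsHermitian := by
  rw [IsHermitian, drift, trace_eq_ofReal_re hH₀, conjTranspose_add, conjTranspose_sub,
    conjTranspose_smul, conjTranspose_smul, hH₀.eq, hV.eq, conjTranspose_one]
  simp

theorem drift_trace (htrV : V.trace = 0) : (drift H₀ V).trace = 0 := by
  rw [drift, trace_add, trace_sub, trace_smul, trace_smul, htrV, trace_one]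
  simp
  ring

theorem add_smul_eq_drift (c : ℝ) :
    H₀ + ((exceptionalValue H₀ V + c : ℝ) : ℂ) • V =
      ((1 / 2 : ℂ) * H₀.trace) • 1 + (drift H₀ V + (c : ℂ) • V) := by
  rw [drift, Complex.ofReal_add, add_smul]
  abel

theorem ne_zero_of_commutator_ne_zero (hcomm : H₀ * V - V * H₀ ≠ 0) : V ≠ 0 := by
  rintro rfl
  simp at hcomm

theorem drift_ne_zero (hcomm : H₀ * V - V * H₀ ≠ 0) : drift H₀ V ≠ 0 := by
  intro h
  apply hcomm
  have h1 : H₀ = ((1 / 2 : ℂ) * H₀.trace) • 1 - (exceptionalValue H₀ V : ℂ) • V := by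
    rw [drift] at h
    rw [eq_sub_iff_add_eq, ← sub_eq_zero, ← h]
    abel
  rw [h1]
  generalize ((1 / 2 : ℂ) * H₀.trace) = a
  simp [sub_mul, mul_sub]

theorem matrixSpectralNorm_pos {A : Matrix (Fin 2) (Fin 2) ℂ} (hA : A ≠ 0) :
    0 < matrixSpectralNorm A := by
  rw [matrixSpectralNorm, norm_pos_iff]
  exact (map_ne_zero_iff _ (Matrix.toEuclideanCLM (n := Fin 2) (𝕜 := ℂ)).injective).2 hA

theorem trace_mul_self (hV : V.IsHermitian) (htrV : V.trace = 0) :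
    (V * V).trace = ((2 * matrixSpectralNorm V ^ 2 : ℝ) : ℂ) := by
  rw [mul_self_of_isHermitian hV htrV, trace_smul, trace_one]
  simp
  ring

theorem drift_mul_trace (hH₀ : H₀.IsHermitian) (hV : V.IsHermitian) (htrV : V.trace = 0)
    (hV0 : V ≠ 0) : (drift H₀ V * V).trace = 0 := by
  have h1 : (H₀ * V).trace = ((H₀ * V).trace.re : ℂ) := by
    have h := trace_conjTranspose (H₀ * V)
    rw [conjTranspose_mul, hH₀.eq, hV.eq, trace_mul_comm] at h
    exact (Complex.conj_eq_iff_re.1 h.symm).symm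
  have h2 := trace_mul_self hV htrV
  have h3 : (matrixSpectralNorm V : ℂ) ≠ 0 :=
    Complex.ofReal_ne_zero.2 (matrixSpectralNorm_pos hV0).ne'
  rw [drift, add_mul, sub_mul, trace_add, trace_sub, smul_mul_assoc, smul_mul_assoc, trace_smul,
    trace_smul, one_mul, htrV, exceptionalValue, h2, h1]
  simp only [Complex.ofReal_re, smul_eq_mul]
  push_cast
  field_simp
  ring

theorem commutator_drift_mul (hH₀ : H₀.IsHermitian) (hV : V.IsHermitian) (htrV : V.trace = 0)
    (hV0 : V ≠ 0) (c : ℝ) :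
    (H₀ + (c : ℂ) • V) * (drift H₀ V * V) - drift H₀ V * V * (H₀ + (c : ℂ) • V) =
      ((2 * matrixSpectralNorm (drift H₀ V) ^ 2 : ℝ) : ℂ) • V -
        ((2 * matrixSpectralNorm V ^ 2 * (c - exceptionalValue H₀ V) : ℝ) : ℂ) • drift H₀ V := by
  have htr := drift_trace (H₀ := H₀) htrV
  have hD2 := mul_self_of_isHermitian (drift_isHermitian hH₀ hV) htr
  have hV2 := mul_self_of_isHermitian hV htrV
  have hanti := mul_eq_neg_mul_of_trace_eq_zero htrV htr
    ((trace_mul_comm _ _).trans (drift_mul_trace hH₀ hV htrV hV0))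
  have hH : H₀ + (c : ℂ) • V = ((1 / 2 : ℂ) * H₀.trace) • 1 +
      (drift H₀ V + ((c - exceptionalValue H₀ V : ℝ) : ℂ) • V) := by
    rw [← add_smul_eq_drift]
    simp
  rw [hH]
  generalize ((1 / 2 : ℂ) * H₀.trace) = a
  generalize drift H₀ V = D at *
  have e1 : D * (D * V) = ((matrixSpectralNorm D ^ 2 : ℝ) : ℂ) • V := by
    rw [← Matrix.mul_assoc, hD2, smul_mul_assoc, one_mul]
  have e2 : D * V * D = -(((matrixSpectralNorm D ^ 2 : ℝ) : ℂ) • V) := by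
    rw [Matrix.mul_assoc, hanti, mul_neg, e1]
  have e3 : D * V * V = ((matrixSpectralNorm V ^ 2 : ℝ) : ℂ) • D := by
    rw [Matrix.mul_assoc, hV2, mul_smul_comm, mul_one]
  have e4 : V * (D * V) = -(((matrixSpectralNorm V ^ 2 : ℝ) : ℂ) • D) := by
    rw [← Matrix.mul_assoc, hanti, neg_mul, e3]
  simp only [add_mul, mul_add, smul_mul_assoc, mul_smul_comm, one_mul, mul_one, e1, e2, e3, e4]
  push_cast
  module

theorem commutator_eq_drift_mul (hH₀ : H₀.IsHermitian) (hV : V.IsHermitian) (htrV : V.trace = 0)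
    (hV0 : V ≠ 0) (c : ℝ) :
    (H₀ + (c : ℂ) • V) * V - V * (H₀ + (c : ℂ) • V) = (2 : ℂ) • (drift H₀ V * V) := by
  have hanti := mul_eq_neg_mul_of_trace_eq_zero htrV (drift_trace (H₀ := H₀) htrV)
    ((trace_mul_comm _ _).trans (drift_mul_trace hH₀ hV htrV hV0))
  have hH : H₀ + (c : ℂ) • V = ((1 / 2 : ℂ) * H₀.trace) • 1 +
      (drift H₀ V + ((c - exceptionalValue H₀ V : ℝ) : ℂ) • V) := by
    rw [← add_smul_eq_drift]
    simp
  rw [hH]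
  generalize ((1 / 2 : ℂ) * H₀.trace) = a
  simp only [add_mul, mul_add, smul_mul_assoc, mul_smul_comm, one_mul, mul_one, hanti]
  module

end Drift

/-! ## Controllability along a trajectory -/

section Rank

open scoped Matrix.Norms.L2Operator

variable {H₀ V Z : Matrix (Fin 2) (Fin 2) ℂ} {T : ℝ} {f : ℝ → ℝ}
  {U : ℝ → Matrix (Fin 2) (Fin 2) ℂ}

/-- The functional `B ↦ Tr (Z B)`. -/
noncomputable def traceMulCLM (Z : Matrix (Fin 2) (Fin 2) ℂ) : Matrix (Fin 2) (Fin 2) ℂ →L[ℝ] ℂ :=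
  LinearMap.toContinuousLinearMap
    ((Matrix.traceLinearMap (Fin 2) ℝ ℂ).comp (LinearMap.mulLeft ℝ Z))

theorem traceMulCLM_apply (Z B : Matrix (Fin 2) (Fin 2) ℂ) :
    traceMulCLM Z B = (Z * B).trace := rfl

theorem continuousOn_trace_mul_conj (hT : 0 ≤ T) (hU : IsEvolution H₀ V T f U)
    (Z B : Matrix (Fin 2) (Fin 2) ℂ) :
    ContinuousOn (fun t ↦ (Z * ((U t)ᴴ * B * U t)).trace) (Icc 0 T) := by
  have hc := hU.continuousOn hT
  exact (traceMulCLM Z).continuous.comp_continuousOn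
    (((continuousOn_conjTranspose hc).mul continuousOn_const).mul hc)

theorem ae_trace_mul_heisenberg_eq_zero (hH₀ : H₀.IsHermitian) (hV : V.IsHermitian)
    (hU : IsEvolution H₀ V T f U) {B : Matrix (Fin 2) (Fin 2) ℂ}
    (h : ∀ t ∈ Icc 0 T, (Z * ((U t)ᴴ * B * U t)).trace = 0) :
    ∀ᵐ t, t ∈ Icc 0 T → (Z * heisenberg H₀ V B f f U U t).trace = 0 := by
  have h0 : ∀ᵐ x : ℝ, x ≠ 0 := by simp [ae_iff, measure_singleton]
  have h1 : ∀ᵐ x : ℝ, x ≠ T := by simp [ae_iff, measure_singleton]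
  filter_upwards [hU.ae_hasDerivAt_conj hH₀ hV hU B, h0, h1] with t ht ht0 htT htm
  have hd := (traceMulCLM Z).hasFDerivAt.comp_hasDerivAt t (ht htm)
  have hz : HasDerivAt (traceMulCLM Z ∘ fun s ↦ (U s)ᴴ * B * U s) 0 t := by
    refine (hasDerivAt_const t (0 : ℂ)).congr_of_eventuallyEq ?_
    filter_upwards [Icc_mem_nhds (lt_of_le_of_ne htm.1 (Ne.symm ht0))
      (lt_of_le_of_ne htm.2 htT)] with x hx
    exact h x hx
  exact hd.unique hz

theorem trace_mul_drift_mul_eq_zero (hT : 0 < T) (hH₀ : H₀.IsHermitian) (hV : V.IsHermitian)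
    (htrV : V.trace = 0) (hV0 : V ≠ 0) (hU : IsEvolution H₀ V T f U)
    (h : ∀ t ∈ Icc 0 T, (Z * ((U t)ᴴ * V * U t)).trace = 0) :
    ∀ t ∈ Icc 0 T, (Z * ((U t)ᴴ * (drift H₀ V * V) * U t)).trace = 0 := by
  have hae := ae_trace_mul_heisenberg_eq_zero hH₀ hV hU h
  refine Measure.eqOn_Icc_of_ae_eq volume hT.ne (g := fun _ ↦ (0 : ℂ)) ?_
    (continuousOn_trace_mul_conj hT.le hU Z _) continuousOn_const
  refine (ae_restrict_iff' measurableSet_Icc).2 ?_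
  filter_upwards [hae] with t ht htm
  have := ht htm
  rw [heisenberg, commutator_eq_drift_mul hH₀ hV htrV hV0] at this
  simpa only [smul_mul_assoc, mul_smul_comm, trace_smul, smul_eq_zero, Complex.I_ne_zero,
    two_ne_zero, false_or] using this

theorem eq_zero_of_trace_mul_conj_eq_zero (hT : 0 < T) (hH₀ : H₀.IsHermitian) (hV : V.IsHermitian)
    (htrV : V.trace = 0) (hcomm : H₀ * V - V * H₀ ≠ 0) (hf : IntegrableOn f (Icc 0 T))
    (hU : IsEvolution H₀ V T f U)
    (hne : ¬ ∀ᵐ t ∂(volume.restrict (Icc 0 T)), f t = exceptionalValue H₀ V)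
    (hZ : Z.trace = 0) (h : ∀ t ∈ Icc 0 T, (Z * ((U t)ᴴ * V * U t)).trace = 0) : Z = 0 := by
  have hV0 := ne_zero_of_commutator_ne_zero hcomm
  have hD0 := drift_ne_zero hcomm
  have h2 := trace_mul_drift_mul_eq_zero hT hH₀ hV htrV hV0 hU h
  have hae := (ae_restrict_iff' measurableSet_Icc).2
    (ae_trace_mul_heisenberg_eq_zero hH₀ hV hU h2)
  have hfreq : ∃ᶠ t in ae (volume.restrict (Icc 0 T)), f t ≠ exceptionalValue H₀ V :=
    Filter.not_eventually.1 hne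
  obtain ⟨t, ht, ht', htm⟩ :=
    (hfreq.and_eventually (hae.and (ae_restrict_mem measurableSet_Icc))).exists
  have hUt := hU.conjTranspose_mul_self hT.le hH₀ hV hf htm
  have hcyc : ∀ B, (Z * ((U t)ᴴ * B * U t)).trace = (U t * Z * (U t)ᴴ * B).trace := by
    intro B
    rw [← Matrix.mul_assoc, trace_mul_comm]
    simp only [Matrix.mul_assoc]
  have e1 := (hcyc V).symm.trans (h t htm)
  have e2 := (hcyc _).symm.trans (h2 t htm)
  rw [heisenberg, hcyc, commutator_drift_mul hH₀ hV htrV hV0, mul_smul_comm, mul_sub,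
    mul_smul_comm, mul_smul_comm, trace_smul, trace_sub, trace_smul, trace_smul, e1,
    smul_zero, zero_sub, smul_neg, neg_eq_zero, smul_eq_zero, smul_eq_zero] at ht'
  have hVn := matrixSpectralNorm_pos hV0
  have e3 := (ht'.resolve_left Complex.I_ne_zero).resolve_left (by
    exact Complex.ofReal_ne_zero.2 (mul_ne_zero (by positivity) (sub_ne_zero.2 ht)))
  have e0 : (U t * Z * (U t)ᴴ).trace = 0 := by
    rw [trace_mul_comm, ← Matrix.mul_assoc, hUt, one_mul, hZ]
  have hDn := matrixSpectralNorm_pos hD0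
  have hzero := eq_zero_of_trace_mul_eq_zero (drift_trace (H₀ := H₀) htrV) htrV
    (drift_mul_trace hH₀ hV htrV hV0)
    (mul_self_of_isHermitian (drift_isHermitian hH₀ hV) (drift_trace htrV))
    (mul_self_of_isHermitian hV htrV) (Complex.ofReal_ne_zero.2 (by positivity))
    (Complex.ofReal_ne_zero.2 (by positivity)) e0 e3 e1 e2
  calc Z = (U t)ᴴ * (U t * Z * (U t)ᴴ) * U t := by
        simp only [Matrix.mul_assoc]
        rw [hUt, mul_one, ← Matrix.mul_assoc, hUt, one_mul]
    _ = 0 := by rw [hzero, mul_zero, zero_mul]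

end Rank

/-! ## First variation of the objective -/

section Variation

open scoped Matrix.Norms.L2Operator Topology

variable {H₀ V W : Matrix (Fin 2) (Fin 2) ℂ} {T : ℝ}

theorem Control.coeFn_add_smul (f g : Control T) (ε : ℝ) :
    (f + ε • g : Control T) =ᵐ[volume.restrict (Icc 0 T)] fun t ↦ f t + ε * g t := by
  filter_upwards [Lp.coeFn_add f (ε • g), Lp.coeFn_smul ε g] with t h1 h2
  rw [h1, Pi.add_apply, h2, Pi.smul_apply, smul_eq_mul]

theorem evolution_unitary (hT : 0 ≤ T) (hH₀ : H₀.IsHermitian) (hV : V.IsHermitian)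
    (f : Control T) {t : ℝ} (ht : t ∈ Icc 0 T) :
    (evolution H₀ V f t)ᴴ * evolution H₀ V f t = 1 :=
  (evolution_isEvolution H₀ V f).conjTranspose_mul_self hT hH₀ hV f.integrableOn ht

theorem conj_intervalIntegrable (hT : 0 ≤ T) {U : ℝ → Matrix (Fin 2) (Fin 2) ℂ} {g : ℝ → ℝ}
    (hU : ContinuousOn U (Icc 0 T)) (hg : IntegrableOn g (Icc 0 T)) :
    IntervalIntegrable (fun s ↦ (g s : ℂ) • (-Complex.I) • ((U s)ᴴ * V * U s)) volume 0 T := by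
  have hgi : IntervalIntegrable g volume 0 T :=
    (intervalIntegrable_iff_integrableOn_Icc_of_le hT).2 hg
  have hc := continuousOn_conjTranspose hU
  rw [← uIcc_of_le hT] at hc hU
  refine (((intervalIntegrable_ofReal_smul hgi ((-Complex.I) • V)).continuousOn_mul hc
    ).mul_continuousOn hU).congr ?_
  intro t _
  simp only [smul_mul_assoc, mul_smul_comm]

theorem hasDerivAt_conj_evolution (hT : 0 ≤ T) (hH₀ : H₀.IsHermitian) (hV : V.IsHermitian)
    (f g : Control T) :
    HasDerivAt (fun ε : ℝ ↦ (evolution H₀ V f T)ᴴ * evolution H₀ V (f + ε • g) T)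
      (∫ s in (0 : ℝ)..T, (g s : ℂ) • (-Complex.I) •
        ((evolution H₀ V f s)ᴴ * V * evolution H₀ V f s)) 0 := by
  rw [hasDerivAt_iff_isLittleO]
  have h0 : (evolution H₀ V f T)ᴴ * evolution H₀ V (f + (0 : ℝ) • g) T = 1 := by
    rw [zero_smul, add_zero]
    exact evolution_unitary hT hH₀ hV f ⟨hT, le_rfl⟩
  simp only [h0, sub_zero]
  refine Asymptotics.IsBigO.trans_isLittleO (g := fun ε : ℝ ↦ ε ^ 2) ?_
    (Asymptotics.isLittleO_pow_id one_lt_two)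
  refine Asymptotics.IsBigO.of_bound ((‖V‖ * ∫ s in (0 : ℝ)..T, |g s|) ^ 2)
    (Filter.Eventually.of_forall fun ε ↦ ?_)
  rw [Real.norm_of_nonneg (sq_nonneg ε)]
  exact norm_conj_sub_firstVariation_le hT hH₀ hV f.integrableOn g.integrableOn ε
    (evolution_isEvolution H₀ V f)
    ((evolution_isEvolution H₀ V (f + ε • g)).congr_ae (Control.coeFn_add_smul f g ε))

theorem hasDerivAt_trace_evolution (hT : 0 ≤ T) (hH₀ : H₀.IsHermitian) (hV : V.IsHermitian)
    (C : Matrix (Fin 2) (Fin 2) ℂ) (f g : Control T) :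
    HasDerivAt (fun ε : ℝ ↦ (C * evolution H₀ V (f + ε • g) T).trace)
      (∫ s in (0 : ℝ)..T, (g s : ℂ) * (-Complex.I * (C * evolution H₀ V f T *
        ((evolution H₀ V f s)ᴴ * V * evolution H₀ V f s)).trace)) 0 := by
  have hc := (evolution_isEvolution H₀ V f).continuousOn hT
  have h := (traceMulCLM (C * evolution H₀ V f T)).hasFDerivAt.comp_hasDerivAt (0 : ℝ)
    (hasDerivAt_conj_evolution hT hH₀ hV f g)
  rw [← ContinuousLinearMap.intervalIntegral_comp_comm _
    (conj_intervalIntegrable hT hc g.integrableOn)] at h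
  have hU := mul_eq_one_comm.1 (evolution_unitary hT hH₀ hV f (t := T) ⟨hT, le_rfl⟩)
  refine (h.congr_of_eventuallyEq (Filter.Eventually.of_forall fun ε ↦ ?_)).congr_deriv ?_
  · simp only [Function.comp_apply, traceMulCLM_apply]
    rw [Matrix.mul_assoc, ← Matrix.mul_assoc (evolution H₀ V f T), hU, one_mul]
  · refine intervalIntegral.integral_congr fun s _ ↦ ?_
    simp only [traceMulCLM_apply, mul_smul_comm, trace_smul, smul_eq_mul]

theorem hasDerivAt_gateObjective (hT : 0 ≤ T) (hH₀ : H₀.IsHermitian) (hV : V.IsHermitian)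
    (f g : Control T) :
    HasDerivAt (fun ε : ℝ ↦ gateObjective H₀ V W T (f + ε • g))
      (∫ s in (0 : ℝ)..T, g s * ((1 / 2) * (star (Wᴴ * evolution H₀ V f T).trace *
        (Wᴴ * evolution H₀ V f T *
          ((evolution H₀ V f s)ᴴ * V * evolution H₀ V f s)).trace).im)) 0 := by
  have h := ((hasDerivAt_trace_evolution hT hH₀ hV Wᴴ f g).norm_sq).const_mul (1 / 4 : ℝ)
  refine h.congr_deriv ?_
  rw [zero_smul, add_zero]
  set z := (Wᴴ * evolution H₀ V f T).trace
  have hi : IntervalIntegrable (fun s ↦ (g s : ℂ) * (-Complex.I * (Wᴴ * evolution H₀ V f T *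
        ((evolution H₀ V f s)ᴴ * V * evolution H₀ V f s)).trace)) volume 0 T := by
    have h1 := conj_intervalIntegrable (V := V) hT
      ((evolution_isEvolution H₀ V f).continuousOn hT) g.integrableOn
    have h2 : IntervalIntegrable _ volume 0 T :=
      ⟨(traceMulCLM (Wᴴ * evolution H₀ V f T)).integrable_comp h1.1,
        (traceMulCLM (Wᴴ * evolution H₀ V f T)).integrable_comp h1.2⟩
    refine h2.congr ?_
    intro s _
    simp only [traceMulCLM_apply, mul_smul_comm, trace_smul, smul_eq_mul]
  have h3 := ContinuousLinearMap.intervalIntegral_comp_comm (𝕜 := ℝ) (innerSL ℝ z) hi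
  rw [innerSL_apply_apply] at h3
  rw [← h3, ← intervalIntegral.integral_const_mul, ← intervalIntegral.integral_const_mul]
  refine intervalIntegral.integral_congr fun s _ ↦ ?_
  simp only [innerSL_apply_apply, Complex.inner, Complex.star_def]
  simp [Complex.mul_re, Complex.mul_im]
  ring

theorem eq_zero_of_integral_control_mul_eq_zero (hT : 0 < T) {φ : ℝ → ℝ}
    (hφ : ContinuousOn φ (Icc 0 T))
    (h : ∀ g : Control T, ∫ s in (0 : ℝ)..T, g s * φ s = 0) : ∀ t ∈ Icc 0 T, φ t = 0 := by
  have hi : Integrable φ (volume.restrict (Icc 0 T)) := hφ.integrableOn_Icc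
  have h1 := h (hi.toL1 φ)
  have h2 : ∫ s in Icc 0 T, φ s * φ s = 0 := by
    rw [intervalIntegral.integral_of_le hT.le, ← integral_Icc_eq_integral_Ioc] at h1
    refine (integral_congr_ae ?_).trans h1
    filter_upwards [hi.coeFn_toL1] with t ht
    rw [ht]
  have h3 := (integral_eq_zero_iff_of_nonneg (fun t ↦ mul_self_nonneg (φ t))
    (hφ.mul hφ).integrableOn_Icc).1 h2
  refine Measure.eqOn_Icc_of_ae_eq volume hT.ne (g := fun _ ↦ (0 : ℝ)) ?_ hφ continuousOn_const
  filter_upwards [h3] with t ht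
  exact mul_self_eq_zero.1 ht

theorem trace_conj_eq_zero_of_eventually (hT : 0 < T) (hH₀ : H₀.IsHermitian) (hV : V.IsHermitian)
    {C : Matrix (Fin 2) (Fin 2) ℂ} {f : Control T}
    (h : ∀ᶠ f' in 𝓝 f, (C * evolution H₀ V f' T).trace = 0) :
    ∀ t ∈ Icc 0 T, (C * evolution H₀ V f T *
      ((evolution H₀ V f t)ᴴ * V * evolution H₀ V f t)).trace = 0 := by
  have hU := evolution_isEvolution H₀ V f
  have hc := continuousOn_trace_mul_conj hT.le hU (C * evolution H₀ V f T) V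
  have hg : ∀ g : Control T, ∫ s in (0 : ℝ)..T, (g s : ℂ) * (-Complex.I *
      (C * evolution H₀ V f T * ((evolution H₀ V f s)ᴴ * V * evolution H₀ V f s)).trace) = 0 := by
    intro g
    refine (hasDerivAt_trace_evolution hT.le hH₀ hV C f g).unique ?_
    refine (hasDerivAt_const (0 : ℝ) (0 : ℂ)).congr_of_eventuallyEq ?_
    have hcont : Filter.Tendsto (fun ε : ℝ ↦ f + ε • g) (𝓝 0) (𝓝 f) := by
      have : Continuous fun ε : ℝ ↦ f + ε • g := by fun_prop
      simpa using this.tendsto 0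
    exact hcont.eventually h
  have hint : ∀ g : Control T, IntervalIntegrable (fun s ↦ (g s : ℂ) * (-Complex.I *
      (C * evolution H₀ V f T * ((evolution H₀ V f s)ᴴ * V * evolution H₀ V f s)).trace))
      volume 0 T := by
    intro g
    have h1 := conj_intervalIntegrable (V := V) hT.le (hU.continuousOn hT.le) g.integrableOn
    have h2 : IntervalIntegrable _ volume 0 T :=
      ⟨(traceMulCLM (C * evolution H₀ V f T)).integrable_comp h1.1,
        (traceMulCLM (C * evolution H₀ V f T)).integrable_comp h1.2⟩
    refine h2.congr ?_
    intro s _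
    simp only [traceMulCLM_apply, mul_smul_comm, trace_smul, smul_eq_mul]
  set ψ : ℝ → ℂ := fun t ↦ (C * evolution H₀ V f T *
      ((evolution H₀ V f t)ᴴ * V * evolution H₀ V f t)).trace with hψ
  have him := eq_zero_of_integral_control_mul_eq_zero hT
    (φ := fun t ↦ (ψ t).im) (Complex.continuous_im.comp_continuousOn hc) fun g ↦ by
      have h1 := Complex.reCLM.intervalIntegral_comp_comm (hint g)
      rw [hg g, map_zero] at h1
      refine (intervalIntegral.integral_congr fun s _ ↦ ?_).trans h1
      simp [hψ]
  have hre := eq_zero_of_integral_control_mul_eq_zero hT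
    (φ := fun t ↦ -(ψ t).re) (Complex.continuous_re.comp_continuousOn hc).neg fun g ↦ by
      have h1 := Complex.imCLM.intervalIntegral_comp_comm (hint g)
      rw [hg g, map_zero] at h1
      refine (intervalIntegral.integral_congr fun s _ ↦ ?_).trans h1
      simp [hψ]
  intro t ht
  exact Complex.ext (neg_eq_zero.1 (hre t ht)) (him t ht)

end Variation

/-! ## Critical points -/

section Critical

open scoped Topology

variable {H₀ V W : Matrix (Fin 2) (Fin 2) ℂ} {T : ℝ}

theorem gate_unitary (hT : 0 ≤ T) (hH₀ : H₀.IsHermitian) (hV : V.IsHermitian)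
    (hW : W ∈ Matrix.unitaryGroup (Fin 2) ℂ) (f : Control T) :
    (Wᴴ * evolution H₀ V f T)ᴴ * (Wᴴ * evolution H₀ V f T) = 1 := by
  have h1 : W * Wᴴ = 1 := Matrix.mem_unitaryGroup_iff.1 hW
  rw [conjTranspose_mul, conjTranspose_conjTranspose, Matrix.mul_assoc, ← Matrix.mul_assoc W, h1,
    one_mul, evolution_unitary hT hH₀ hV f ⟨hT, le_rfl⟩]

theorem gateObjective_nonneg (f : Control T) : 0 ≤ gateObjective H₀ V W T f := by
  unfold gateObjective
  positivity

theorem gateObjective_le_one (hT : 0 ≤ T) (hH₀ : H₀.IsHermitian) (hV : V.IsHermitian)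
    (hW : W ∈ Matrix.unitaryGroup (Fin 2) ℂ) (f : Control T) : gateObjective H₀ V W T f ≤ 1 := by
  have := norm_trace_sq_le_of_unitary (gate_unitary hT hH₀ hV hW f)
  unfold gateObjective
  linarith

theorem trace_skew_conj_eq_zero_of_isCriticalControl (hT : 0 < T) (hH₀ : H₀.IsHermitian)
    (hV : V.IsHermitian) {f : Control T} (hf : IsCriticalControl (gateObjective H₀ V W T) f) :
    ∀ t ∈ Icc 0 T, ((star (Wᴴ * evolution H₀ V f T).trace • (Wᴴ * evolution H₀ V f T) -
      (Wᴴ * evolution H₀ V f T).trace • (Wᴴ * evolution H₀ V f T)ᴴ) *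
        ((evolution H₀ V f t)ᴴ * V * evolution H₀ V f t)).trace = 0 := by
  have hU := evolution_isEvolution H₀ V f
  have hc := continuousOn_trace_mul_conj hT.le hU (Wᴴ * evolution H₀ V f T) V
  set X := Wᴴ * evolution H₀ V f T with hX
  intro t ht
  have h := eq_zero_of_integral_control_mul_eq_zero hT
    (φ := fun t ↦ (1 / 2) * (star X.trace *
      (X * ((evolution H₀ V f t)ᴴ * V * evolution H₀ V f t)).trace).im)
    (continuousOn_const.mul (Complex.continuous_im.comp_continuousOn (continuousOn_const.mul hc)))
    (fun g ↦ (hasDerivAt_gateObjective hT.le hH₀ hV f g).unique (hf g)) t ht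
  have him := (mul_eq_zero.1 h).resolve_left (by norm_num)
  have hherm : ((evolution H₀ V f t)ᴴ * V * evolution H₀ V f t).IsHermitian :=
    isHermitian_conjTranspose_mul_mul _ hV
  have hconj := star_trace_mul (A := X) hherm
  rw [sub_mul, trace_sub, smul_mul_assoc, smul_mul_assoc, trace_smul, trace_smul, ← hconj,
    smul_eq_mul, smul_eq_mul]
  have hreal := Complex.conj_eq_iff_im.2 him
  rw [map_mul] at hreal
  simp only [Complex.star_def, Complex.conj_conj] at hreal ⊢
  rw [hreal, sub_self]

theorem skew_trace_eq_zero (X : Matrix (Fin 2) (Fin 2) ℂ) :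
    (star X.trace • X - X.trace • Xᴴ).trace = 0 := by
  rw [trace_sub, trace_smul, trace_smul, trace_conjTranspose, smul_eq_mul, smul_eq_mul]
  ring

theorem isCriticalControl_of_isLocalExtr (hT : 0 < T) (hH₀ : H₀.IsHermitian) (hV : V.IsHermitian)
    {f : Control T} (hf : IsLocalExtr (gateObjective H₀ V W T) f) :
    IsCriticalControl (gateObjective H₀ V W T) f := by
  intro g
  have h := hasDerivAt_gateObjective (W := W) hT.le hH₀ hV f g
  have hcont : Continuous fun ε : ℝ ↦ f + ε • g := by fun_prop
  have hext : IsLocalExtr (gateObjective H₀ V W T ∘ fun ε : ℝ ↦ f + ε • g) 0 := by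
    refine IsLocalExtr.comp_continuous ?_ hcont.continuousAt
    simpa using hf
  have hz := hext.hasDerivAt_eq_zero h
  rw [HasLineDerivAt]
  rwa [hz] at h

theorem gateObjective_eq_of_isCriticalControl (hT : 0 < T) (hH₀ : H₀.IsHermitian)
    (hV : V.IsHermitian) (hcomm : H₀ * V - V * H₀ ≠ 0) (htrV : V.trace = 0)
    (hW : W ∈ Matrix.unitaryGroup (Fin 2) ℂ) {f : Control T}
    (hf : IsCriticalControl (gateObjective H₀ V W T) f)
    (hne : ¬ ∀ᵐ t ∂(volume.restrict (Icc 0 T)), f t = exceptionalValue H₀ V) :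
    gateObjective H₀ V W T f = 0 ∨ gateObjective H₀ V W T f = 1 := by
  have hZ := eq_zero_of_trace_mul_conj_eq_zero hT hH₀ hV htrV hcomm f.integrableOn
    (evolution_isEvolution H₀ V f) hne (skew_trace_eq_zero _)
    (trace_skew_conj_eq_zero_of_isCriticalControl hT hH₀ hV hf)
  rcases eq_or_ne (Wᴴ * evolution H₀ V f T).trace 0 with hz | hz
  · left
    simp [gateObjective, hz]
  · right
    have := norm_trace_sq_eq_of_smul_eq (gate_unitary hT.le hH₀ hV hW f) hz hZ
    rw [gateObjective, this]
    norm_num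

theorem not_eventually_gateObjective_eq_one (hT : 0 < T) (hH₀ : H₀.IsHermitian)
    (hV : V.IsHermitian) (htrV : V.trace = 0) (hV0 : V ≠ 0)
    (hW : W ∈ Matrix.unitaryGroup (Fin 2) ℂ) (f : Control T) :
    ¬ ∀ᶠ f' in 𝓝 f, gateObjective H₀ V W T f' = 1 := by
  intro h
  have key : ∀ f' : Control T, gateObjective H₀ V W T f' = 1 →
      (2 : ℂ) • (Wᴴ * evolution H₀ V f' T) = (Wᴴ * evolution H₀ V f' T).trace • 1 := by
    intro f' hf'
    refine eq_smul_one_of_norm_trace_sq_eq (gate_unitary hT.le hH₀ hV hW f') ?_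
    unfold gateObjective at hf'
    linarith
  have h1 : ∀ᶠ f' in 𝓝 f, (V * Wᴴ * evolution H₀ V f' T).trace = 0 := by
    filter_upwards [h] with f' hf'
    have := congrArg (fun A ↦ (V * A).trace) (key f' hf')
    simp only [mul_smul_comm, trace_smul, mul_one, htrV, smul_eq_mul, mul_zero] at this
    rw [Matrix.mul_assoc]
    exact (mul_eq_zero.1 this).resolve_left two_ne_zero
  have h2 := trace_conj_eq_zero_of_eventually hT hH₀ hV h1 0 ⟨le_rfl, hT.le⟩
  rw [(evolution_isEvolution H₀ V f).init, conjTranspose_one, one_mul, mul_one, Matrix.mul_assoc V]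
    at h2
  have hf := h.self_of_nhds
  have hX := key f hf
  have h3 : (2 : ℂ) • (V * (Wᴴ * evolution H₀ V f T) * V).trace =
      (Wᴴ * evolution H₀ V f T).trace * (V * V).trace := by
    rw [← trace_smul, ← smul_mul_assoc, ← mul_smul_comm, hX, mul_smul_comm, mul_one,
      smul_mul_assoc, trace_smul, smul_eq_mul]
  rw [h2, smul_zero, trace_mul_self hV htrV] at h3
  have hVn := matrixSpectralNorm_pos hV0
  rcases mul_eq_zero.1 h3.symm with h4 | h4
  · simp [gateObjective, h4] at hf
  · exact Complex.ofReal_ne_zero.2 (by positivity) h4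

theorem exists_near_not_ae_eq (hT : 0 < T) {p : Control T → Prop} {f : Control T}
    (h : ∀ᶠ f' in 𝓝 f, p f') (c : ℝ) :
    ∃ f' : Control T, (∀ᶠ f'' in 𝓝 f', p f'') ∧
      ¬ ∀ᵐ t ∂(volume.restrict (Icc 0 T)), f' t = c := by
  by_cases hc : ∀ᵐ t ∂(volume.restrict (Icc 0 T)), f t = c
  · let g : Control T := (integrable_const (1 : ℝ)).toL1 (fun _ ↦ (1 : ℝ))
    have hcont : Filter.Tendsto (fun ε : ℝ ↦ f + ε • g) (𝓝 0) (𝓝 f) := by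
      have : Continuous fun ε : ℝ ↦ f + ε • g := by fun_prop
      simpa using this.tendsto 0
    have h1 := hcont.eventually h.eventually_nhds
    obtain ⟨ε, hε, hε0⟩ := ((h1.filter_mono nhdsWithin_le_nhds).and
      (self_mem_nhdsWithin : Ioi (0 : ℝ) ∈ 𝓝[>] 0)).exists
    refine ⟨f + ε • g, hε, fun hae ↦ ?_⟩
    have hfalse : ∀ᵐ t ∂(volume.restrict (Icc 0 T)), False := by
      filter_upwards [hc, hae, Control.coeFn_add_smul f g ε,
        (integrable_const (μ := volume.restrict (Icc 0 T)) (1 : ℝ)).coeFn_toL1] with t e1 e2 e3 e4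
      rw [e3, e1, e4] at e2
      have : ε = 0 := by linarith
      exact hε0.ne' this
    rw [Filter.eventually_false_iff_eq_bot, ae_eq_bot, Measure.restrict_eq_zero,
      Real.volume_Icc, ENNReal.ofReal_eq_zero] at hfalse
    linarith
  · exact ⟨f, h.eventually_nhds.self_of_nhds, hc⟩

theorem not_eventually_gateObjective_eq_zero (hT : 0 < T) (hH₀ : H₀.IsHermitian)
    (hV : V.IsHermitian) (hcomm : H₀ * V - V * H₀ ≠ 0) (htrV : V.trace = 0)
    (hW : W ∈ Matrix.unitaryGroup (Fin 2) ℂ) (f : Control T) :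
    ¬ ∀ᶠ f' in 𝓝 f, gateObjective H₀ V W T f' = 0 := by
  intro h
  obtain ⟨f₁, hf₁, hne⟩ := exists_near_not_ae_eq hT h (exceptionalValue H₀ V)
  have h1 : ∀ᶠ f' in 𝓝 f₁, (Wᴴ * evolution H₀ V f' T).trace = 0 := by
    filter_upwards [hf₁] with f' hf'
    simpa [gateObjective] using hf'
  have hX := eq_zero_of_trace_mul_conj_eq_zero hT hH₀ hV htrV hcomm f₁.integrableOn
    (evolution_isEvolution H₀ V f₁) hne h1.self_of_nhds
    (trace_conj_eq_zero_of_eventually hT hH₀ hV h1)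
  have hu := gate_unitary hT.le hH₀ hV hW f₁
  rw [hX, mul_zero] at hu
  exact zero_ne_one hu

end Critical

/-! ## Square-wave perturbations of the exceptional control -/

section RealEstimates

open Filter
open scoped Topology

/-- The frequency of the traceless Hamiltonian `D + c V`. -/
noncomputable def freq (ω ν c : ℝ) : ℝ := √(ω ^ 2 + c ^ 2 * ν)

/-- The trace of the propagator over half a period of the square wave with values `c`, `σ c`. -/
noncomputable def waveTrace (ω ν σ c : ℝ) : ℝ :=
  2 * (Real.cos (freq ω ν c * (Real.pi / ω / 4)) ^ 2 -
    (Real.sin (freq ω ν c * (Real.pi / ω / 4)) / freq ω ν c) ^ 2 * (ω ^ 2 + σ * c ^ 2 * ν))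

/-- The coefficient of the drift in the propagator over half a period of the square wave. -/
noncomputable def waveCoeff (ω ν c : ℝ) : ℝ :=
  2 * Real.cos (freq ω ν c * (Real.pi / ω / 4)) *
    (Real.sin (freq ω ν c * (Real.pi / ω / 4)) / freq ω ν c)

variable {ω ν : ℝ}

theorem freq_sq (hω : 0 < ω) (hν : 0 < ν) (c : ℝ) : freq ω ν c ^ 2 = ω ^ 2 + c ^ 2 * ν :=
  Real.sq_sqrt (by positivity)

theorem freq_pos (hω : 0 < ω) (hν : 0 < ν) (c : ℝ) : 0 < freq ω ν c :=
  Real.sqrt_pos.2 (by positivity)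

theorem freq_zero (hω : 0 < ω) : freq ω ν 0 = ω := by
  simp [freq, Real.sqrt_sq hω.le]

theorem lt_freq (hω : 0 < ω) (hν : 0 < ν) {c : ℝ} (hc : 0 < c) : ω < freq ω ν c := by
  refine lt_of_pow_lt_pow_left₀ 2 (freq_pos hω hν c).le ?_
  rw [freq_sq hω hν]
  have : 0 < c ^ 2 * ν := by positivity
  linarith

theorem continuous_freq : Continuous (freq ω ν) := by
  unfold freq
  fun_prop

theorem continuous_waveTrace (hω : 0 < ω) (hν : 0 < ν) (σ : ℝ) :
    Continuous (waveTrace ω ν σ) := by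
  have h : ∀ c, freq ω ν c ≠ 0 := fun c ↦ (freq_pos hω hν c).ne'
  have := continuous_freq (ω := ω) (ν := ν)
  unfold waveTrace
  fun_prop (disch := assumption)

theorem continuous_waveCoeff (hω : 0 < ω) (hν : 0 < ν) : Continuous (waveCoeff ω ν) := by
  have h : ∀ c, freq ω ν c ≠ 0 := fun c ↦ (freq_pos hω hν c).ne'
  have := continuous_freq (ω := ω) (ν := ν)
  unfold waveCoeff
  fun_prop (disch := assumption)

theorem waveTrace_zero (hω : 0 < ω) (σ : ℝ) : waveTrace ω ν σ 0 = 0 := by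
  have h : ω * (Real.pi / ω / 4) = Real.pi / 4 := by field_simp
  rw [waveTrace, freq_zero hω, h, Real.cos_pi_div_four, Real.sin_pi_div_four]
  field_simp
  ring

theorem waveCoeff_zero (hω : 0 < ω) : waveCoeff ω ν 0 = 1 / ω := by
  have h : ω * (Real.pi / ω / 4) = Real.pi / 4 := by field_simp
  have h2 : √(2 : ℝ) ^ 2 = 2 := Real.sq_sqrt (by norm_num)
  rw [waveCoeff, freq_zero hω, h, Real.cos_pi_div_four, Real.sin_pi_div_four]
  field_simp
  linarith

theorem waveTrace_eq (hω : 0 < ω) (hν : 0 < ν) (σ c : ℝ) :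
    waveTrace ω ν σ c = 2 * (Real.cos (Real.pi / 2 * (freq ω ν c / ω)) +
      (1 - Real.cos (Real.pi / 2 * (freq ω ν c / ω))) / 2 *
        ((1 - σ) * (1 - (ω / freq ω ν c) ^ 2))) := by
  have hw := (freq_pos hω hν c).ne'
  have h2 : Real.pi / 2 * (freq ω ν c / ω) = 2 * (freq ω ν c * (Real.pi / ω / 4)) := by
    field_simp
    norm_num
  have hc : c ^ 2 * ν = freq ω ν c ^ 2 - ω ^ 2 := by rw [freq_sq hω hν]; ring
  rw [waveTrace, h2, Real.cos_two_mul, mul_assoc σ, hc, div_pow, Real.sin_sq]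
  field_simp
  ring

theorem waveTrace_one_neg (hω : 0 < ω) (hν : 0 < ν) :
    ∀ᶠ c in 𝓝[>] 0, waveTrace ω ν 1 c < 0 := by
  have h : ∀ᶠ c in 𝓝 0, freq ω ν c < 3 * ω :=
    continuous_freq.continuousAt.eventually_lt continuousAt_const
      (by rw [freq_zero hω]; linarith)
  filter_upwards [h.filter_mono nhdsWithin_le_nhds, self_mem_nhdsWithin] with c hc hc0
  rw [waveTrace_eq hω hν]
  have h1 : 1 < freq ω ν c / ω := (one_lt_div hω).2 (lt_freq hω hν hc0)
  have h2 : freq ω ν c / ω < 3 := (div_lt_iff₀ hω).2 hc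
  have := Real.cos_neg_of_pi_div_two_lt_of_lt (x := Real.pi / 2 * (freq ω ν c / ω))
    (by nlinarith [Real.pi_pos]) (by nlinarith [Real.pi_pos])
  simp only [sub_self, zero_mul, mul_zero, add_zero]
  linarith

theorem waveTrace_neg_one_pos (hω : 0 < ω) (hν : 0 < ν) :
    ∀ᶠ c in 𝓝[>] 0, 0 < waveTrace ω ν (-1) c := by
  have h : ∀ᶠ c in 𝓝 0, freq ω ν c < 11 / 10 * ω :=
    continuous_freq.continuousAt.eventually_lt continuousAt_const
      (by rw [freq_zero hω]; linarith)
  filter_upwards [h.filter_mono nhdsWithin_le_nhds, self_mem_nhdsWithin] with c hc hc0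
  rw [waveTrace_eq hω hν]
  have hw := freq_pos hω hν c
  have h1 : 1 < freq ω ν c / ω := (one_lt_div hω).2 (lt_freq hω hν hc0)
  have h2 : freq ω ν c / ω < 11 / 10 := (div_lt_iff₀ hω).2 hc
  have hρ : ω / freq ω ν c = (freq ω ν c / ω)⁻¹ := (inv_div _ _).symm
  rw [hρ]
  set ρ := freq ω ν c / ω
  have hcos : Real.cos (Real.pi / 2 * ρ) = -Real.sin (Real.pi / 2 * (ρ - 1)) := by
    rw [← Real.cos_add_pi_div_two]
    congr 1
    ring
  have hpos : 0 < Real.pi / 2 * (ρ - 1) := by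
    have := Real.pi_pos
    have : 0 < ρ - 1 := by linarith
    positivity
  have hs := Real.sin_lt hpos
  have hs0 : 0 ≤ Real.sin (Real.pi / 2 * (ρ - 1)) := by
    refine Real.sin_nonneg_of_nonneg_of_le_pi hpos.le ?_
    nlinarith [Real.pi_pos]
  rw [hcos]
  set S := Real.sin (Real.pi / 2 * (ρ - 1))
  have hy : Real.pi / 2 * (ρ - 1) < 1 - ρ⁻¹ ^ 2 := by
    have e : 1 - ρ⁻¹ ^ 2 = (ρ - 1) * ((ρ + 1) / ρ ^ 2) := by
      field_simp
      ring
    rw [e, mul_comm]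
    refine mul_lt_mul_of_pos_left ?_ (by linarith)
    rw [lt_div_iff₀ (by positivity)]
    have hpi := Real.pi_lt_d2
    have hρ2 : ρ ^ 2 < 1.21 := by nlinarith
    nlinarith [Real.pi_pos]
  have hSy : 0 ≤ S * (1 - ρ⁻¹ ^ 2) := mul_nonneg hs0 (by linarith)
  nlinarith

/-- The sign of the second-order effect of a square wave is governed by `σ`. -/
theorem eventually_wave_sign (hω : 0 < ω) (hν : 0 < ν) {r b σ : ℝ} (hr : 0 < r) (hb : b ≠ 0)
    (hσ : σ = 1 ∨ σ = -1) :
    ∀ᶠ c in 𝓝[>] 0,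
      0 < σ * b * ((waveTrace ω ν σ c * (waveTrace ω ν σ c * r / 2 + waveCoeff ω ν c * b)) *
        (waveTrace ω ν σ c * (waveTrace ω ν σ c * r / 2 + waveCoeff ω ν c * b) - 2 * r)) := by
  have hm := continuous_waveTrace hω hν σ
  have hk := continuous_waveCoeff hω hν
  have h1 : ∀ᶠ c in 𝓝 0, 0 < b * (waveTrace ω ν σ c * r / 2 + waveCoeff ω ν c * b) := by
    refine continuousAt_const.eventually_lt (by fun_prop) ?_
    rw [waveTrace_zero hω, waveCoeff_zero hω]
    have : 0 < b ^ 2 / ω := by positivity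
    calc (0 : ℝ) < b ^ 2 / ω := this
      _ = _ := by ring
  have h2 : ∀ᶠ c in 𝓝 0,
      waveTrace ω ν σ c * (waveTrace ω ν σ c * r / 2 + waveCoeff ω ν c * b) < 2 * r := by
    refine ContinuousAt.eventually_lt (by fun_prop) continuousAt_const ?_
    rw [waveTrace_zero hω]
    linarith
  have h3 : ∀ᶠ c in 𝓝[>] 0, σ * waveTrace ω ν σ c < 0 := by
    rcases hσ with rfl | rfl
    · filter_upwards [waveTrace_one_neg hω hν] with c hc
      linarith
    · filter_upwards [waveTrace_neg_one_pos hω hν] with c hc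
      linarith
  filter_upwards [h1.filter_mono nhdsWithin_le_nhds, h2.filter_mono nhdsWithin_le_nhds, h3]
    with c e1 e2 e3
  set m := waveTrace ω ν σ c
  set s := m * r / 2 + waveCoeff ω ν c * b
  have e4 : 0 < (-(σ * m)) * (b * s) * (2 * r - m * s) :=
    mul_pos (mul_pos (by linarith) e1) (by linarith)
  calc 0 < (-(σ * m)) * (b * s) * (2 * r - m * s) := e4
    _ = _ := by ring

end RealEstimates

/-! ## Propagators of constant controls -/

section Propagator

open scoped Matrix.Norms.L2Operator

variable {H₀ V K : Matrix (Fin 2) (Fin 2) ℂ} {T : ℝ} {f : ℝ → ℝ}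
  {U : ℝ → Matrix (Fin 2) (Fin 2) ℂ}

/-- The propagator `exp (-i t K)` for `K² = w²`. -/
noncomputable def rotation (K : Matrix (Fin 2) (Fin 2) ℂ) (w t : ℝ) : Matrix (Fin 2) (Fin 2) ℂ :=
  (Real.cos (w * t) : ℂ) • 1 + (-Complex.I * (Real.sin (w * t) / w : ℝ)) • K

theorem rotation_mul_conjTranspose (hK : K.IsHermitian) {w : ℝ} (hw : w ≠ 0)
    (hK2 : K * K = ((w ^ 2 : ℝ) : ℂ) • 1) (t₁ t₀ : ℝ) :
    rotation K w t₁ * (rotation K w t₀)ᴴ = rotation K w (t₁ - t₀) := by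
  have hc := Real.cos_sub (w * t₁) (w * t₀)
  have hs := Real.sin_sub (w * t₁) (w * t₀)
  rw [rotation, rotation, rotation, conjTranspose_add, conjTranspose_smul, conjTranspose_smul,
    conjTranspose_one, hK.eq, mul_sub w, hc, hs]
  simp only [add_mul, mul_add, smul_mul_assoc, mul_smul_comm, one_mul, mul_one, hK2, smul_smul,
    Complex.star_def, map_mul, map_neg, Complex.conj_I, Complex.conj_ofReal, neg_neg]
  have hw' : (w : ℂ) ≠ 0 := Complex.ofReal_ne_zero.2 hw
  match_scalars
  · field_simp
    linear_combination -(Complex.sin (w * t₁) * Complex.sin (w * t₀)) * Complex.I_sq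
  · field_simp
    ring

theorem hasDerivAt_phase_smul_rotation {w : ℝ} (hw : w ≠ 0)
    (hK2 : K * K = ((w ^ 2 : ℝ) : ℂ) • 1) (τ t : ℝ) :
    HasDerivAt (fun s : ℝ ↦ Complex.exp (-Complex.I * τ * s) • rotation K w s)
      ((-Complex.I) • ((τ : ℂ) • 1 + K) * (Complex.exp (-Complex.I * τ * t) • rotation K w t)) t := by
  have h1 : HasDerivAt (fun s : ℝ ↦ Complex.exp (-Complex.I * τ * s))
      (Complex.exp (-Complex.I * τ * t) * (-Complex.I * τ)) t := by
    have : HasDerivAt (fun s : ℝ ↦ -Complex.I * τ * (s : ℂ)) (-Complex.I * τ) t := by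
      simpa using (Complex.ofRealCLM.hasDerivAt (x := t)).const_mul (-Complex.I * τ)
    exact this.cexp
  have hwt : HasDerivAt (fun s : ℝ ↦ w * s) w t := by
    simpa using (hasDerivAt_id t).const_mul w
  have h2 : HasDerivAt (fun s : ℝ ↦ (Real.cos (w * s) : ℂ)) ((-Real.sin (w * t) * w : ℝ) : ℂ) t :=
    hwt.cos.ofReal_comp
  have h3 : HasDerivAt (fun s : ℝ ↦ -Complex.I * ((Real.sin (w * s) / w : ℝ) : ℂ))
      (-Complex.I * ((Real.cos (w * t) * w / w : ℝ) : ℂ)) t :=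
    (hwt.sin.div_const w).ofReal_comp.const_mul _
  have h4 := h1.fun_smul ((h2.smul_const (1 : Matrix (Fin 2) (Fin 2) ℂ)).fun_add (h3.smul_const K))
  refine h4.congr_deriv ?_
  have hw' : (w : ℂ) ≠ 0 := Complex.ofReal_ne_zero.2 hw
  simp only [rotation, add_mul, mul_add, smul_mul_assoc, mul_smul_comm, one_mul, mul_one, hK2,
    smul_smul, smul_add]
  match_scalars
  · field_simp
    linear_combination (-(w * Complex.sin (t * w))) * Complex.I_sq
  · field_simp

/-- Constant controls have the explicit evolution `exp (-i τ t) (cos (w t) - i sin (w t) K / w)`. -/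
theorem isEvolution_phase_smul_rotation (hT : 0 ≤ T) {w τ c : ℝ} (hw : w ≠ 0)
    (hK2 : K * K = ((w ^ 2 : ℝ) : ℂ) • 1) (hK : H₀ + (c : ℂ) • V = (τ : ℂ) • 1 + K) :
    IsEvolution H₀ V T (fun _ ↦ c)
      (fun t ↦ Complex.exp (-Complex.I * τ * t) • rotation K w t) := by
  have hd := hasDerivAt_phase_smul_rotation hw hK2 τ
  have hcont : Continuous fun t : ℝ ↦ Complex.exp (-Complex.I * τ * t) • rotation K w t :=
    continuous_iff_continuousAt.2 fun t ↦ (hd t).continuousAt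
  rw [isEvolution_iff_integral (integrableOn_const (by simp)) hT]
  refine ⟨hcont.continuousOn, fun t ht ↦ ?_⟩
  simp only [generator, hK]
  rw [intervalIntegral.integral_eq_sub_of_hasDerivAt (fun s _ ↦ hd s)
    ((continuous_const.mul hcont).intervalIntegrable _ _)]
  simp [rotation]

theorem IsEvolution.eq_rotation_mul (hT : 0 ≤ T) (hH₀ : H₀.IsHermitian) (hV : V.IsHermitian)
    (hU : IsEvolution H₀ V T f U) {w τ c t₀ t₁ : ℝ} (hw : w ≠ 0) (hKh : K.IsHermitian)
    (hK2 : K * K = ((w ^ 2 : ℝ) : ℂ) • 1) (hK : H₀ + (c : ℂ) • V = (τ : ℂ) • 1 + K)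
    (h0 : 0 ≤ t₀) (h01 : t₀ ≤ t₁) (h1 : t₁ ≤ T) (hf : ∀ᵐ t, t ∈ Ioc t₀ t₁ → f t = c) :
    Complex.exp (Complex.I * τ * t₁) • U t₁ =
      rotation K w (t₁ - t₀) * (Complex.exp (Complex.I * τ * t₀) • U t₀) := by
  have hE := isEvolution_phase_smul_rotation (T := T) hT hw hK2 hK
  set E : ℝ → Matrix (Fin 2) (Fin 2) ℂ :=
    fun t ↦ Complex.exp (-Complex.I * τ * t) • rotation K w t with hEdef
  have hsub : [[t₀, t₁]] ⊆ [[0, T]] := by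
    rw [uIcc_of_le h01, uIcc_of_le hT]
    exact Icc_subset_Icc h0 h1
  have hne : ∀ᵐ x : ℝ, x ≠ t₀ := by simp [ae_iff, measure_singleton]
  have hae : ∀ᵐ t, t ∈ [[t₀, t₁]] → HasDerivAt (fun s ↦ (E s)ᴴ * 1 * U s) 0 t := by
    filter_upwards [hE.ae_hasDerivAt_conj hH₀ hV hU 1, hf, hne] with t h hft hnt htm
    have h' := h (by rw [← uIcc_of_le hT]; exact hsub htm)
    rw [uIcc_of_le h01] at htm
    rw [heisenberg_one, hft ⟨lt_of_le_of_ne htm.1 (Ne.symm hnt), htm.2⟩] at h'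
    simpa using h'
  have hEE : (E t₀)ᴴ * U t₀ = (E t₁)ᴴ * U t₁ := by
    ext i j
    obtain ⟨C, hC⟩ := ((hE.absCont_conj hU 1 i j).mono hsub).const_of_ae_hasDerivAt_zero (by
      filter_upwards [hae] with t ht htm
      exact hasDerivAt_matrix_iff.1 (ht htm) i j)
    have e0 := hC t₀ left_mem_uIcc
    have e1 := hC t₁ right_mem_uIcc
    rw [mul_one] at e0 e1
    rw [e0, e1]
  have hEu : E t₁ * (E t₁)ᴴ = 1 := mul_eq_one_comm.1
    (hE.conjTranspose_mul_self hT hH₀ hV (integrableOn_const (by simp)) ⟨h0.trans h01, h1⟩)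
  have hexp : ∀ t : ℝ, Complex.exp (Complex.I * τ * t) * Complex.exp (-Complex.I * τ * t) = 1 := by
    intro t
    rw [← Complex.exp_add]
    simp
  have hconj : star (Complex.exp (-Complex.I * τ * t₀)) = Complex.exp (Complex.I * τ * t₀) := by
    rw [Complex.star_def, ← Complex.exp_conj]
    simp
  calc Complex.exp (Complex.I * τ * t₁) • U t₁
      = Complex.exp (Complex.I * τ * t₁) • (E t₁ * ((E t₀)ᴴ * U t₀)) := by
        rw [hEE, ← Matrix.mul_assoc, hEu, one_mul]
    _ = _ := by
        rw [hEdef]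
        simp only [conjTranspose_smul, smul_mul_assoc, mul_smul_comm, smul_smul, hconj]
        rw [← Matrix.mul_assoc, rotation_mul_conjTranspose hKh hw hK2, mul_left_comm, hexp,
          mul_one]

end Propagator

section SquareWave

variable {H₀ V W D X : Matrix (Fin 2) (Fin 2) ℂ} {T : ℝ}

theorem mul_self_eq_trace_smul_sub_det (M : Matrix (Fin 2) (Fin 2) ℂ) :
    M * M = M.trace • M - M.det • 1 := by
  ext i j
  fin_cases i <;> fin_cases j <;>
    simp [Matrix.mul_apply, Fin.sum_univ_two, trace_fin_two, det_fin_two] <;> ring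

theorem det_rotation {K : Matrix (Fin 2) (Fin 2) ℂ} {w : ℝ} (hw : w ≠ 0) (hK : K.trace = 0)
    (hK2 : K * K = ((w ^ 2 : ℝ) : ℂ) • 1) (t : ℝ) : (rotation K w t).det = 1 := by
  have h1 : K.det = -((w : ℂ) ^ 2) := by
    have h := mul_self_eq_trace_smul_sub_det K
    rw [hK2, hK, zero_smul, zero_sub, ← neg_smul] at h
    have := congrFun (congrFun h 0) 0
    simp at this
    rw [this, neg_neg]
  have hw' : (w : ℂ) ≠ 0 := Complex.ofReal_ne_zero.2 hw
  have h2 : (rotation K w t).det = Complex.cos (w * t) ^ 2 + Complex.cos (w * t) *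
      (-Complex.I * (Complex.sin (w * t) / w)) * K.trace +
      (-Complex.I * (Complex.sin (w * t) / w)) ^ 2 * K.det := by
    rw [det_fin_two, det_fin_two, trace_fin_two]
    simp [rotation]
    ring
  rw [h2, hK, h1]
  field_simp
  linear_combination (-(w * Complex.sin (w * t) ^ 2)) * Complex.I_sq +
    w * Complex.cos_sq_add_sin_sq (w * t)

theorem add_smul_mul_add_smul {ω ν : ℝ} (hDV : D * V = -(V * D))
    (hD2 : D * D = ((ω ^ 2 : ℝ) : ℂ) • 1) (hV2 : V * V = (ν : ℂ) • 1) (σ c : ℝ) :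
    (D + ((σ * c : ℝ) : ℂ) • V) * (D + (c : ℂ) • V) =
      ((ω ^ 2 + σ * c ^ 2 * ν : ℝ) : ℂ) • 1 + (((1 - σ) * c : ℝ) : ℂ) • (D * V) := by
  have hVD : V * D = -(D * V) := by rw [hDV, neg_neg]
  simp only [add_mul, mul_add, smul_mul_assoc, mul_smul_comm, hD2, hV2, hVD]
  push_cast
  module

theorem add_smul_mul_self {ω ν : ℝ} (hω : 0 < ω) (hν : 0 < ν) (hDV : D * V = -(V * D))
    (hD2 : D * D = ((ω ^ 2 : ℝ) : ℂ) • 1) (hV2 : V * V = (ν : ℂ) • 1) {σ : ℝ}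
    (hσ : σ = 1 ∨ σ = -1) (c : ℝ) :
    (D + ((σ * c : ℝ) : ℂ) • V) * (D + ((σ * c : ℝ) : ℂ) • V) =
      ((freq ω ν c ^ 2 : ℝ) : ℂ) • 1 := by
  have h := add_smul_mul_add_smul hDV hD2 hV2 1 (σ * c)
  rw [one_mul, sub_self, zero_mul, Complex.ofReal_zero, zero_smul, add_zero] at h
  rw [h, freq_sq hω hν]
  rcases hσ with rfl | rfl <;> simp

/-- The propagator over half a period of the square wave. -/
noncomputable def wavePropagator (D V : Matrix (Fin 2) (Fin 2) ℂ) (ω ν σ c : ℝ) :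
    Matrix (Fin 2) (Fin 2) ℂ :=
  rotation (D + ((σ * c : ℝ) : ℂ) • V) (freq ω ν c) (Real.pi / ω / 4) *
    rotation (D + (c : ℂ) • V) (freq ω ν c) (Real.pi / ω / 4)

theorem trace_mul_wavePropagator {ω ν : ℝ} (hDV : D * V = -(V * D))
    (hD2 : D * D = ((ω ^ 2 : ℝ) : ℂ) • 1) (hV2 : V * V = (ν : ℂ) • 1)
    (hXV : (X * V).trace = 0) (hXDV : (X * (D * V)).trace = 0) (σ c : ℝ) :
    (X * wavePropagator D V ω ν σ c).trace =
      (waveTrace ω ν σ c : ℂ) / 2 * X.trace -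
        Complex.I * waveCoeff ω ν c * (X * D).trace := by
  have h := add_smul_mul_add_smul hDV hD2 hV2 σ c
  rw [wavePropagator, rotation, rotation, waveTrace, waveCoeff]
  set α := Real.cos (freq ω ν c * (Real.pi / ω / 4))
  set β := Real.sin (freq ω ν c * (Real.pi / ω / 4)) / freq ω ν c
  have e : ((α : ℂ) • 1 + (-Complex.I * (β : ℝ)) • (D + ((σ * c : ℝ) : ℂ) • V)) *
      ((α : ℂ) • 1 + (-Complex.I * (β : ℝ)) • (D + (c : ℂ) • V)) =
      ((α : ℂ) ^ 2) • (1 : Matrix (Fin 2) (Fin 2) ℂ) +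
        (-Complex.I * α * β) • ((2 : ℂ) • D + (((1 + σ) * c : ℝ) : ℂ) • V) -
        ((β : ℂ) ^ 2) • ((D + ((σ * c : ℝ) : ℂ) • V) * (D + (c : ℂ) • V)) := by
    have hI : (-Complex.I * (β : ℂ)) * (-Complex.I * (β : ℂ)) = -((β : ℂ) ^ 2) := by
      linear_combination ((β : ℂ) ^ 2) * Complex.I_sq
    rw [add_mul, mul_add, mul_add]
    simp only [smul_mul_assoc, mul_smul_comm, one_mul, mul_one, smul_smul, hI]
    push_cast
    module
  rw [e, h]
  simp only [mul_add, mul_sub, mul_smul_comm, trace_add, trace_sub, trace_smul, hXV, hXDV, mul_one,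
    smul_eq_mul]
  push_cast
  ring

theorem trace_wavePropagator {ω ν : ℝ} (hDV : D * V = -(V * D))
    (hD2 : D * D = ((ω ^ 2 : ℝ) : ℂ) • 1) (hV2 : V * V = (ν : ℂ) • 1) (htrD : D.trace = 0)
    (htrV : V.trace = 0) (htrDV : (D * V).trace = 0) (σ c : ℝ) :
    (wavePropagator D V ω ν σ c).trace = waveTrace ω ν σ c := by
  have h := trace_mul_wavePropagator (X := 1) hDV hD2 hV2 (by rwa [one_mul]) (by rwa [one_mul]) σ c
  rw [one_mul, one_mul, htrD, trace_one] at h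
  rw [h]
  simp

theorem det_wavePropagator {ω ν : ℝ} (hω : 0 < ω) (hν : 0 < ν) (hDV : D * V = -(V * D))
    (hD2 : D * D = ((ω ^ 2 : ℝ) : ℂ) • 1) (hV2 : V * V = (ν : ℂ) • 1) (htrD : D.trace = 0)
    (htrV : V.trace = 0) {σ : ℝ} (hσ : σ = 1 ∨ σ = -1) (c : ℝ) :
    (wavePropagator D V ω ν σ c).det = 1 := by
  have hw := (freq_pos hω hν c).ne'
  have htr : ∀ a : ℂ, (D + a • V).trace = 0 := by
    intro a
    rw [trace_add, trace_smul, htrD, htrV, smul_zero, add_zero]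
  have h1 := add_smul_mul_self hω hν hDV hD2 hV2 (σ := 1) (Or.inl rfl) c
  rw [one_mul] at h1
  rw [wavePropagator, det_mul, det_rotation hw (htr _) h1,
    det_rotation hw (htr _) (add_smul_mul_self hω hν hDV hD2 hV2 hσ c), one_mul]

/-- Two periods of the square wave with values `1`, `σ` on `[0, L]`, extended by zero. -/
noncomputable def squareWave (L σ t : ℝ) : ℝ :=
  if t ≤ L / 4 then 1 else if t ≤ L / 2 then σ else if t ≤ 3 * L / 4 then 1
    else if t ≤ L then σ else 0

theorem integrable_squareWave (L σ T : ℝ) :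
    Integrable (squareWave L σ) (volume.restrict (Icc 0 T)) := by
  have hm : Measurable (squareWave L σ) :=
    Measurable.ite measurableSet_Iic measurable_const (Measurable.ite measurableSet_Iic
      measurable_const (Measurable.ite measurableSet_Iic measurable_const
        (Measurable.ite measurableSet_Iic measurable_const measurable_const)))
  refine Integrable.of_bound hm.aestronglyMeasurable (1 + |σ|) (Filter.Eventually.of_forall ?_)
  intro t
  have := abs_nonneg σ
  rw [squareWave, Real.norm_eq_abs]
  split_ifs <;> simp
  linarith

/-- The square wave as a control. -/
noncomputable def waveControl (T L σ : ℝ) : Control T := (integrable_squareWave L σ T).toL1 _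

theorem add_smul_waveControl {f : Control T} {f₀ : ℝ}
    (hf : ∀ᵐ t ∂(volume.restrict (Icc 0 T)), f t = f₀) (L σ c : ℝ) :
    ∀ᵐ t, t ∈ Icc 0 T → (f + c • waveControl T L σ : Control T) t =
      f₀ + c * squareWave L σ t := by
  rw [← ae_restrict_iff' measurableSet_Icc]
  filter_upwards [hf, Control.coeFn_add_smul f (waveControl T L σ) c,
    (integrable_squareWave L σ T).coeFn_toL1] with t h1 h2 h3
  rw [h2, h1, waveControl, h3]

theorem evolution_waveControl (hH₀ : H₀.IsHermitian) (hV : V.IsHermitian)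
    (hcomm : H₀ * V - V * H₀ ≠ 0) (htrV : V.trace = 0)
    (hT : Real.pi / matrixSpectralNorm (drift H₀ V) ≤ T) {f : Control T}
    (hf : ∀ᵐ t ∂(volume.restrict (Icc 0 T)), f t = exceptionalValue H₀ V) {σ : ℝ}
    (hσ : σ = 1 ∨ σ = -1) (c : ℝ) :
    evolution H₀ V (f + c • waveControl T (Real.pi / matrixSpectralNorm (drift H₀ V)) σ) T =
      -(evolution H₀ V f T *
        (wavePropagator (drift H₀ V) V (matrixSpectralNorm (drift H₀ V))
          (matrixSpectralNorm V ^ 2) σ c *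
        wavePropagator (drift H₀ V) V (matrixSpectralNorm (drift H₀ V))
          (matrixSpectralNorm V ^ 2) σ c)) := by
  have hV0 := ne_zero_of_commutator_ne_zero hcomm
  have hω := matrixSpectralNorm_pos (drift_ne_zero hcomm)
  have hν : 0 < matrixSpectralNorm V ^ 2 := pow_pos (matrixSpectralNorm_pos hV0) 2
  have hDh := drift_isHermitian hH₀ hV
  have htrD := drift_trace (H₀ := H₀) htrV
  have hDV := mul_eq_neg_mul_of_trace_eq_zero htrD htrV (drift_mul_trace hH₀ hV htrV hV0)
  have hD2 := mul_self_of_isHermitian hDh htrD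
  have hV2 := mul_self_of_isHermitian hV htrV
  have hH : ∀ a : ℝ, H₀ + ((exceptionalValue H₀ V + a : ℝ) : ℂ) • V =
      ((H₀.trace.re / 2 : ℝ) : ℂ) • 1 + (drift H₀ V + (a : ℂ) • V) := by
    intro a
    rw [add_smul_eq_drift]
    congr 2
    conv_lhs => rw [trace_eq_ofReal_re hH₀]
    push_cast
    ring
  rw [wavePropagator]
  generalize drift H₀ V = D at *
  generalize matrixSpectralNorm D = ω at *
  generalize matrixSpectralNorm V ^ 2 = ν at *
  set L := Real.pi / ω with hL
  set τ := H₀.trace.re / 2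
  have hL0 : 0 < L := div_pos Real.pi_pos hω
  have hT0 : 0 ≤ T := hL0.le.trans hT
  have hw := (freq_pos hω hν c).ne'
  set w := freq ω ν c
  have hKh : ∀ a : ℝ, (D + (a : ℂ) • V).IsHermitian := by
    intro a
    rw [IsHermitian, conjTranspose_add, conjTranspose_smul, hDh.eq, hV.eq]
    simp
  have hK1 : (D + (c : ℂ) • V) * (D + (c : ℂ) • V) = ((w ^ 2 : ℝ) : ℂ) • 1 := by
    simpa using add_smul_mul_self hω hν hDV hD2 hV2 (σ := 1) (Or.inl rfl) c
  have hKσ := add_smul_mul_self hω hν hDV hD2 hV2 hσ c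
  have hK0 : H₀ + (exceptionalValue H₀ V : ℂ) • V = (τ : ℂ) • 1 + D := by simpa using hH 0
  have hae := add_smul_waveControl hf L σ c
  set U := evolution H₀ V (f + c • waveControl T L σ) with hUdef
  have hU : IsEvolution H₀ V T _ U := evolution_isEvolution H₀ V _
  have hU₀ := evolution_isEvolution H₀ V f
  have s1 := hU.eq_rotation_mul hT0 hH₀ hV (t₀ := 0) (t₁ := L / 4) hw (hKh c) hK1 (hH c) le_rfl
    (by linarith) (by linarith) (by
      filter_upwards [hae] with t ht htm
      have h1 := htm.1
      have h2 := htm.2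
      rw [ht ⟨by linarith, by linarith⟩, squareWave, if_pos h2, mul_one])
  have s2 := hU.eq_rotation_mul hT0 hH₀ hV (t₀ := L / 4) (t₁ := L / 2) hw (hKh _) hKσ (hH _)
    (by linarith) (by linarith) (by linarith) (by
      filter_upwards [hae] with t ht htm
      have h1 := htm.1
      have h2 := htm.2
      rw [ht ⟨by linarith, by linarith⟩, squareWave, if_neg (by linarith), if_pos h2, mul_comm])
  have s3 := hU.eq_rotation_mul hT0 hH₀ hV (t₀ := L / 2) (t₁ := 3 * L / 4) hw (hKh c) hK1 (hH c)
    (by linarith) (by linarith) (by linarith) (by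
      filter_upwards [hae] with t ht htm
      have h1 := htm.1
      have h2 := htm.2
      rw [ht ⟨by linarith, by linarith⟩, squareWave, if_neg (by linarith), if_neg (by linarith),
        if_pos h2, mul_one])
  have s4 := hU.eq_rotation_mul hT0 hH₀ hV (t₀ := 3 * L / 4) (t₁ := L) hw (hKh _) hKσ (hH _)
    (by linarith) (by linarith) (by linarith) (by
      filter_upwards [hae] with t ht htm
      have h1 := htm.1
      have h2 := htm.2
      rw [ht ⟨by linarith, by linarith⟩, squareWave, if_neg (by linarith), if_neg (by linarith),
        if_neg (by linarith), if_pos h2, mul_comm])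
  have s5 := hU.eq_rotation_mul hT0 hH₀ hV (t₀ := L) (t₁ := T) hω.ne' hDh hD2 hK0 hL0.le hT le_rfl
    (by
      filter_upwards [hae] with t ht htm
      have h1 := htm.1
      have h2 := htm.2
      rw [ht ⟨by linarith, by linarith⟩, squareWave, if_neg (by linarith), if_neg (by linarith),
        if_neg (by linarith), if_neg (by linarith), mul_zero, add_zero])
  have hf' := (ae_restrict_iff' measurableSet_Icc).1 hf
  have r1 := hU₀.eq_rotation_mul hT0 hH₀ hV (t₀ := 0) (t₁ := L) hω.ne' hDh hD2 hK0 le_rfl hL0.le hT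
    (by
      filter_upwards [hf'] with t ht htm
      exact ht ⟨htm.1.le, htm.2.trans hT⟩)
  have r2 := hU₀.eq_rotation_mul hT0 hH₀ hV (t₀ := L) (t₁ := T) hω.ne' hDh hD2 hK0 hL0.le hT le_rfl
    (by
      filter_upwards [hf'] with t ht htm
      exact ht ⟨hL0.le.trans htm.1.le, htm.2⟩)
  have hrot : rotation D ω (L - 0) = -1 := by
    have : ω * (L - 0) = Real.pi := by rw [hL]; field_simp; simp
    rw [rotation, this, Real.cos_pi, Real.sin_pi]
    simp
  have d2 : L / 2 - L / 4 = L / 4 := by ring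
  have d3 : 3 * L / 4 - L / 2 = L / 4 := by ring
  have d4 : L - 3 * L / 4 = L / 4 := by ring
  rw [r1, hrot, hU₀.init] at r2
  rw [s4, s3, s2, s1, hU.init, d2, d3, d4, sub_zero] at s5
  simp only [Complex.ofReal_zero, mul_zero, Complex.exp_zero, one_smul, mul_one] at r2 s5
  have hexp : Complex.exp (Complex.I * τ * T) ≠ 0 := Complex.exp_ne_zero _
  refine smul_right_injective _ hexp ?_
  simp only
  rw [s5, smul_neg, ← smul_mul_assoc, r2]
  simp only [mul_neg, mul_one, neg_mul, neg_neg, Matrix.mul_assoc]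

end SquareWave

/-! ## The exceptional control is a saddle -/

section Saddle

open Filter
open scoped Topology

variable {H₀ V W : Matrix (Fin 2) (Fin 2) ℂ} {T : ℝ}

theorem exists_waveControl_variation (hT₀ : 0 < T) (hH₀ : H₀.IsHermitian) (hV : V.IsHermitian)
    (hcomm : H₀ * V - V * H₀ ≠ 0) (htrV : V.trace = 0)
    (hW : W ∈ Matrix.unitaryGroup (Fin 2) ℂ)
    (hT : Real.pi / matrixSpectralNorm (drift H₀ V) ≤ T) {f : Control T}
    (hf : ∀ᵐ t ∂(volume.restrict (Icc 0 T)), f t = exceptionalValue H₀ V)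
    (hcrit : IsCriticalControl (gateObjective H₀ V W T) f)
    (h0 : gateObjective H₀ V W T f ≠ 0) (h1 : gateObjective H₀ V W T f ≠ 1) :
    ∃ b : ℝ, b ≠ 0 ∧ ∀ σ : ℝ, σ = 1 ∨ σ = -1 → ∃ g : Control T, ∀ᶠ c in 𝓝[>] (0 : ℝ),
      0 < σ * b * (gateObjective H₀ V W T (f + c • g) - gateObjective H₀ V W T f) := by
  have hV0 := ne_zero_of_commutator_ne_zero hcomm
  have hω := matrixSpectralNorm_pos (drift_ne_zero hcomm)
  have hν : 0 < matrixSpectralNorm V ^ 2 := pow_pos (matrixSpectralNorm_pos hV0) 2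
  have hDh := drift_isHermitian hH₀ hV
  have htrD := drift_trace (H₀ := H₀) htrV
  have htrDV := drift_mul_trace hH₀ hV htrV hV0
  have hDV := mul_eq_neg_mul_of_trace_eq_zero htrD htrV htrDV
  have hD2 := mul_self_of_isHermitian hDh htrD
  have hV2 := mul_self_of_isHermitian hV htrV
  have hU := evolution_isEvolution H₀ V f
  have hskew := trace_skew_conj_eq_zero_of_isCriticalControl hT₀ hH₀ hV hcrit
  have hZDV := trace_mul_drift_mul_eq_zero hT₀ hH₀ hV htrV hV0 hU hskew 0 ⟨le_rfl, hT₀.le⟩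
  have hZV := hskew 0 ⟨le_rfl, hT₀.le⟩
  have hXu := gate_unitary hT₀.le hH₀ hV hW f
  have hsum := smul_add_smul_conjTranspose_of_unitary hXu
  have hwave := fun σ hσ ↦ evolution_waveControl hH₀ hV hcomm htrV hT hf (σ := σ) hσ
  rw [hU.init, conjTranspose_one, one_mul, mul_one] at hZV hZDV
  unfold gateObjective at h0 h1
  set X := Wᴴ * evolution H₀ V f T with hX
  have hz : X.trace ≠ 0 := by
    intro hz
    simp [hz] at h0
  have hr : 0 < ‖X.trace‖ ^ 2 := by positivity
  set Z := star X.trace • X - X.trace • Xᴴ with hZ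
  have hXZ : (2 : ℂ) • (star X.trace • X) = (X.trace * star X.trace) • 1 + Z := by
    rw [← hsum, hZ, two_smul]
    abel
  have htrX : ∀ B : Matrix (Fin 2) (Fin 2) ℂ, B.trace = 0 →
      2 * (star X.trace * (X * B).trace) = (Z * B).trace := by
    intro B hB
    have := congrArg (fun A ↦ (A * B).trace) hXZ
    simpa only [add_mul, smul_mul_assoc, one_mul, trace_add, trace_smul, hB, smul_eq_mul, mul_zero,
      zero_add] using this
  have hvan : ∀ B : Matrix (Fin 2) (Fin 2) ℂ, B.trace = 0 → (Z * B).trace = 0 →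
      (X * B).trace = 0 := by
    intro B hB hZB
    have := htrX B hB
    rw [hZB] at this
    exact ((mul_eq_zero.1 ((mul_eq_zero.1 this).resolve_left two_ne_zero)).resolve_left
      (star_ne_zero.2 hz))
  have hXV := hvan V htrV hZV
  have hXDV := hvan _ htrDV hZDV
  have hZstar : Zᴴ = -Z := by
    rw [hZ, conjTranspose_sub, conjTranspose_smul, conjTranspose_smul, conjTranspose_conjTranspose,
      star_star, neg_sub]
  set b : ℝ := (star X.trace * (X * drift H₀ V).trace).im with hb
  have hbI : star X.trace * (X * drift H₀ V).trace = Complex.I * b := by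
    have h2 := htrX _ htrD
    have h3 := star_trace_mul (A := Z) hDh
    rw [hZstar, neg_mul, trace_neg, ← h2] at h3
    have h4 := congrArg Complex.re h3
    rw [show ∀ x : ℂ, (star x).re = x.re from fun _ ↦ rfl, Complex.neg_re] at h4
    have h5 : (star X.trace * (X * drift H₀ V).trace).re = 0 := by
      have h6 : ∀ x : ℂ, (2 * x).re = 2 * x.re := fun x ↦ by simp
      rw [h6] at h4
      linarith
    apply Complex.ext
    · rw [h5]
      simp
    · rw [hb]
      simp
  have hb0 : b ≠ 0 := by
    intro hb0
    rw [hb0, Complex.ofReal_zero, mul_zero] at hbI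
    have h2 := htrX _ htrD
    rw [hbI, mul_zero] at h2
    have hZ0 := eq_zero_of_trace_mul_eq_zero htrD htrV htrDV hD2 hV2
      (Complex.ofReal_ne_zero.2 (pow_pos hω 2).ne') (Complex.ofReal_ne_zero.2 hν.ne')
      (skew_trace_eq_zero X) h2.symm hZV hZDV
    have := norm_trace_sq_eq_of_smul_eq hXu hz hZ0
    rw [this] at h1
    norm_num at h1
  refine ⟨b, hb0, fun σ hσ ↦ ⟨waveControl T (Real.pi / matrixSpectralNorm (drift H₀ V)) σ, ?_⟩⟩
  filter_upwards [eventually_wave_sign hω hν hr hb0 hσ] with c hc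
  have hM := mul_self_eq_trace_smul_sub_det (wavePropagator (drift H₀ V) V
    (matrixSpectralNorm (drift H₀ V)) (matrixSpectralNorm V ^ 2) σ c)
  rw [det_wavePropagator hω hν hDV hD2 hV2 htrD htrV hσ,
    trace_wavePropagator hDV hD2 hV2 htrD htrV htrDV] at hM
  have hXM := trace_mul_wavePropagator (X := X) hDV hD2 hV2 hXV hXDV σ c
  have hnew := hwave σ hσ c
  rw [hM] at hnew
  unfold gateObjective
  rw [hnew, mul_neg, ← Matrix.mul_assoc, ← hX]
  set m := waveTrace (matrixSpectralNorm (drift H₀ V)) (matrixSpectralNorm V ^ 2) σ c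
  set κ := waveCoeff (matrixSpectralNorm (drift H₀ V)) (matrixSpectralNorm V ^ 2) c
  set M := wavePropagator (drift H₀ V) V
    (matrixSpectralNorm (drift H₀ V)) (matrixSpectralNorm V ^ 2) σ c
  set r := ‖X.trace‖ ^ 2 with hrdef
  have hzz : star X.trace * X.trace = (r : ℂ) := by
    rw [mul_comm, norm_trace_sq]
  have hprod : star X.trace * (-(X * ((m : ℂ) • M - (1 : ℂ) • 1))).trace =
      ((r - m * (m * r / 2 + κ * b) : ℝ) : ℂ) := by
    rw [trace_neg, mul_sub, mul_smul_comm, one_smul, mul_one, trace_sub, trace_smul, hXM,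
      smul_eq_mul]
    push_cast
    linear_combination (1 - (m : ℂ) ^ 2 / 2) * hzz + (Complex.I * m * κ) * hbI +
      (m * κ * b : ℂ) * Complex.I_sq
  have hnorm : r * ‖(-(X * ((m : ℂ) • M - (1 : ℂ) • 1))).trace‖ ^ 2 =
      (r - m * (m * r / 2 + κ * b)) ^ 2 := by
    have := congrArg (fun x : ℂ ↦ ‖x‖ ^ 2) hprod
    simpa only [norm_mul, mul_pow, norm_star, Complex.norm_real, Real.norm_eq_abs, sq_abs] using this
  set y := ‖(-(X * ((m : ℂ) • M - (1 : ℂ) • 1))).trace‖ ^ 2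
  have hfin : σ * b * ((m * (m * r / 2 + κ * b)) * (m * (m * r / 2 + κ * b) - 2 * r)) =
      4 * r * (σ * b * (1 / 4 * y - 1 / 4 * r)) := by
    linear_combination (-(σ * b)) * hnorm
  rw [hfin] at hc
  exact pos_of_mul_pos_right hc (by positivity)

theorem tendsto_add_smul_nhdsGT (f g : Control T) :
    Tendsto (fun c : ℝ ↦ f + c • g) (𝓝[>] 0) (𝓝 f) := by
  have : Continuous fun ε : ℝ ↦ f + ε • g := by fun_prop
  simpa using (this.tendsto 0).mono_left nhdsWithin_le_nhds

theorem gateObjective_eq_of_isLocalExtr (hT₀ : 0 < T) (hH₀ : H₀.IsHermitian) (hV : V.IsHermitian)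
    (hcomm : H₀ * V - V * H₀ ≠ 0) (htrV : V.trace = 0)
    (hW : W ∈ Matrix.unitaryGroup (Fin 2) ℂ)
    (hT : Real.pi / matrixSpectralNorm (drift H₀ V) ≤ T) {f : Control T}
    (hext : IsLocalExtr (gateObjective H₀ V W T) f) :
    gateObjective H₀ V W T f = 0 ∨ gateObjective H₀ V W T f = 1 := by
  have hcrit := isCriticalControl_of_isLocalExtr hT₀ hH₀ hV hext
  by_cases hf : ∀ᵐ t ∂(volume.restrict (Icc 0 T)), f t = exceptionalValue H₀ V
  · by_contra! hne
    obtain ⟨b, hb, hσ⟩ :=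
      exists_waveControl_variation hT₀ hH₀ hV hcomm htrV hW hT hf hcrit hne.1 hne.2
    have key : ∀ s : ℝ, s = 1 ∨ s = -1 → ∃ g : Control T, ∀ᶠ c in 𝓝[>] (0 : ℝ),
        0 < s * (gateObjective H₀ V W T (f + c • g) - gateObjective H₀ V W T f) := by
      intro s hs
      rcases hb.lt_or_gt with hneg | hpos
      · obtain ⟨g, hg⟩ := hσ (-s) (by rcases hs with rfl | rfl <;> simp)
        refine ⟨g, hg.mono fun c hc ↦ ?_⟩
        have : 0 < -b * (s * (gateObjective H₀ V W T (f + c • g) - gateObjective H₀ V W T f)) := by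
          linarith
        exact pos_of_mul_pos_right this (by linarith)
      · obtain ⟨g, hg⟩ := hσ s hs
        refine ⟨g, hg.mono fun c hc ↦ ?_⟩
        have : 0 < b * (s * (gateObjective H₀ V W T (f + c • g) - gateObjective H₀ V W T f)) := by
          linarith
        exact pos_of_mul_pos_right this hpos.le
    rcases hext with hmin | hmax
    · obtain ⟨g, hg⟩ := key (-1) (Or.inr rfl)
      obtain ⟨c, h1, h2⟩ :=
        (((tendsto_add_smul_nhdsGT f g).eventually hmin).and hg).exists
      linarith
    · obtain ⟨g, hg⟩ := key 1 (Or.inl rfl)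
      obtain ⟨c, h1, h2⟩ :=
        (((tendsto_add_smul_nhdsGT f g).eventually hmax).and hg).exists
      linarith
  · exact gateObjective_eq_of_isCriticalControl hT₀ hH₀ hV hcomm htrV hW hcrit hf

end Saddle

end QubitControl

theorem theorem3 (H₀ V W : Matrix (Fin 2) (Fin 2) ℂ) (T : ℝ)
    (hH₀ : H₀.IsHermitian) (hV : V.IsHermitian)
    (hcomm : H₀ * V - V * H₀ ≠ 0) (htrV : V.trace = 0)
    (hW : W ∈ Matrix.unitaryGroup (Fin 2) ℂ) (hT₀ : 0 < T)
    (hT : Real.pi / QubitControl.matrixSpectralNorm (H₀ - ((1 / 2 : ℂ) * H₀.trace) • 1 +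
      (QubitControl.exceptionalValue H₀ V : ℂ) • V) ≤ T) :
    (∀ f : QubitControl.Control T, IsLocalMax (QubitControl.gateObjective H₀ V W T) f →
      IsMaxOn (QubitControl.gateObjective H₀ V W T) Set.univ f ∧
        QubitControl.gateObjective H₀ V W T f = 1) ∧
    (∀ f : QubitControl.Control T, IsLocalMin (QubitControl.gateObjective H₀ V W T) f →
      IsMinOn (QubitControl.gateObjective H₀ V W T) Set.univ f ∧
        QubitControl.gateObjective H₀ V W T f = 0) ∧
    (∀ f : QubitControl.Control T,
      ¬ (∀ᵐ t ∂(MeasureTheory.volume.restrict (Set.Icc 0 T)),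
        f t = QubitControl.exceptionalValue H₀ V) →
      QubitControl.IsCriticalControl (QubitControl.gateObjective H₀ V W T) f →
      (IsMaxOn (QubitControl.gateObjective H₀ V W T) Set.univ f ∧
        QubitControl.gateObjective H₀ V W T f = 1) ∨
      (IsMinOn (QubitControl.gateObjective H₀ V W T) Set.univ f ∧
        QubitControl.gateObjective H₀ V W T f = 0)) := by
  have hmax : ∀ f : QubitControl.Control T, QubitControl.gateObjective H₀ V W T f = 1 →
      IsMaxOn (QubitControl.gateObjective H₀ V W T) Set.univ f := fun f hf f' _ ↦ by
    simpa only [Set.mem_ofPred_eq, hf] using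
      QubitControl.gateObjective_le_one hT₀.le hH₀ hV hW f'
  have hmin : ∀ f : QubitControl.Control T, QubitControl.gateObjective H₀ V W T f = 0 →
      IsMinOn (QubitControl.gateObjective H₀ V W T) Set.univ f := fun f hf f' _ ↦ by
    simpa only [Set.mem_ofPred_eq, hf] using QubitControl.gateObjective_nonneg f'
  refine ⟨fun f hf ↦ ?_, fun f hf ↦ ?_, fun f hne hf ↦ ?_⟩
  · rcases QubitControl.gateObjective_eq_of_isLocalExtr hT₀ hH₀ hV hcomm htrV hW hT (Or.inr hf)
      with h | h
    · refine absurd ?_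
        (QubitControl.not_eventually_gateObjective_eq_zero hT₀ hH₀ hV hcomm htrV hW f)
      filter_upwards [hf] with f' hf'
      exact le_antisymm (hf'.trans h.le) (QubitControl.gateObjective_nonneg f')
    · exact ⟨hmax f h, h⟩
  · rcases QubitControl.gateObjective_eq_of_isLocalExtr hT₀ hH₀ hV hcomm htrV hW hT (Or.inl hf)
      with h | h
    · exact ⟨hmin f h, h⟩
    · refine absurd ?_ (QubitControl.not_eventually_gateObjective_eq_one hT₀ hH₀ hV htrV
        (QubitControl.ne_zero_of_commutator_ne_zero hcomm) hW f)
      filter_upwards [hf] with f' hf'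
      exact le_antisymm (QubitControl.gateObjective_le_one hT₀.le hH₀ hV hW f') (h.ge.trans hf')
  · rcases QubitControl.gateObjective_eq_of_isCriticalControl hT₀ hH₀ hV hcomm htrV hW hf hne
      with h | h
    · exact Or.inr ⟨hmin f h, h⟩
    · exact Or.inl ⟨hmax f h, h⟩
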